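/- Let $k$ be an algebraically closed field of characteristic different from $2$ and $3$. A K3 quartic surface is a surface $X\subset\mathbb P^3_k$ of degree $4$ whose singular points are all (isolated) rational double points. For a line $l\subset X$, the pencil of planes $\Pi_t$ ($t\in\mathbb P^1$) containing $l$ induces a fibration $\pi: Z\to\mathbb P^1$ on the minimal desingularization $Z$ of $X$, hence by restriction a morphism $\hat l\to\mathbb P^1$ from the strict transform $\hat l\cong l$ of $l$. Let $E_t$ be the residual cubic of $l$ in $X\cap\Pi_t$; the morphism sends a general point $P \in l$ to the parameter $t$ of the plane $\Pi_t$ such that $P\in E_t$. In coordinates in which $l$ is $x_0=x_1=0$ and $\Pi_t$ is $x_0=t x_1$, the cubic $E_t$ meets $l$ where $t\,\alpha(x_2,x_3)+\beta(x_2,x_3)=0$ for certain binary cubic forms $\alpha,\beta$, and the morphism is $[x_2:x_3]\mapsto t=-\beta/\alpha$. If this morphism is not constant, $l$ is said to be of the second kind if the Hessian of $E_t$, restricted to $l$, becomes the zero form in $x_2,x_3$ after $t$ is eliminated by means of $t\alpha+\beta=0$ (that is, a general point of $l$ is an inflection point of the residual cubic through it). Let $l$ and $m$ be two distinct intersecting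 lines on a K3 quartic surface $X$. Suppose that both induced morphisms $\hat l\to\mathbb P^1$ and $\hat m\to\mathbb P^1$ have degree $3$ and exactly two points of ramification, and that both $l$ and $m$ are of the second kind. Then $X$ is projectively equivalent over $k$ to Schur's quartic $$x_0^4-x_0x_3^3=x_1^4-x_1x_2^3.$$ -/

import Mathlib

open MvPolynomial

namespace K3Quartic

noncomputable section

/-! Points of projective three-space over `k` are non-zero vectors of `Fin 4 → k` up to scaling, a
line is a two-dimensional subspace of `Fin 4 → k`, and a quartic surface is given by its equation,
a form `F` of degree 4 in the variables `X 0, …, X 3`. -/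

/-- The form `x ↦ F (A x)`: the equation `F` after the linear change of coordinates `A`. -/
def changeCoords {k : Type*} [Field k] (A : GL (Fin 4) k) (F : MvPolynomial (Fin 4) k) :
    MvPolynomial (Fin 4) k :=
  bind₁ (fun i => ∑ j, C ((A : Matrix (Fin 4) (Fin 4) k) i j) * X j) F

/-- The surfaces `F = 0` and `G = 0` differ by a projective linear transformation. -/
def ProjectivelyEquivalent {k : Type*} [Field k] (F G : MvPolynomial (Fin 4) k) : Prop :=
  ∃ (A : GL (Fin 4) k) (c : k), c ≠ 0 ∧ changeCoords A F = C c * G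

/-- Schur's quartic `x₀⁴ - x₀ x₃³ = x₁⁴ - x₁ x₂³`. -/
def schurQuartic (k : Type*) [Field k] : MvPolynomial (Fin 4) k :=
  (X 0 ^ 4 - X 0 * X 3 ^ 3) - (X 1 ^ 4 - X 1 * X 2 ^ 3)

/-- The normal forms of the equations of rational double points over an algebraically closed field
of characteristic different from 2 and 3: types `A_n`, `D_n`, `E_6`, `E_7`, `E_8`. In
characteristic 5 (and only there) the last equation is not equivalent to the one before it; this
is the second form of `E_8` in Artin's classification. -/
inductive ADENormalForm {k : Type*} [Field k] : MvPolynomial (Fin 3) k → Prop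
  | A (n : ℕ) (hn : 1 ≤ n) : ADENormalForm (X 0 * X 1 + X 2 ^ (n + 1))
  | D (n : ℕ) (hn : 4 ≤ n) : ADENormalForm (X 0 ^ 2 + X 1 ^ 2 * X 2 + X 2 ^ (n - 1))
  | E6 : ADENormalForm (X 0 ^ 2 + X 1 ^ 3 + X 2 ^ 4)
  | E7 : ADENormalForm (X 0 ^ 2 + X 1 ^ 3 + X 1 * X 2 ^ 3)
  | E8 : ADENormalForm (X 0 ^ 2 + X 1 ^ 3 + X 2 ^ 5)
  | E8' : ADENormalForm (X 0 ^ 2 + X 1 ^ 3 + X 2 ^ 5 + X 1 * X 2 ^ 4)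

/-- `p` is (a representative of) a singular point of the surface `F = 0`. -/
def IsSingularPoint {k : Type*} [Field k] (F : MvPolynomial (Fin 4) k) (p : Fin 4 → k) : Prop :=
  p ≠ 0 ∧ eval p F = 0 ∧ ∀ i, eval p (pderiv i F) = 0

/-- The surface `F = 0` has a rational double point at `p`: in affine coordinates centred at `p`,
the equation becomes one of the ADE normal forms after a formal change of coordinates
and multiplication by an invertible power series. Equivalently, the completed local ring of the
surface at `p` is that of an ADE singularity. -/
def IsRationalDoublePoint {k : Type*} [Field k] (F : MvPolynomial (Fin 4) k) (p : Fin 4 → k) :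
    Prop :=
  ∃ A : GL (Fin 4) k, (A : Matrix (Fin 4) (Fin 4) k).mulVec (Pi.single 3 1) = p ∧
    ∃ (φ : MvPowerSeries (Fin 3) k ≃ₐ[k] MvPowerSeries (Fin 3) k) (g : MvPolynomial (Fin 3) k),
      ADENormalForm g ∧
      Associated
        (φ (bind₁ ![X 0, X 1, X 2, 1] (changeCoords A F) : MvPolynomial (Fin 3) k))
        (g : MvPowerSeries (Fin 3) k)

/-- `F = 0` is a K3 quartic surface: a surface of degree 4 all of whose singular points are
rational double points. (Rational double points of a surface are isolated singular points.) -/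
structure IsK3Quartic {k : Type*} [Field k] (F : MvPolynomial (Fin 4) k) : Prop where
  isHomogeneous : F.IsHomogeneous 4
  ne_zero : F ≠ 0
  rationalDoublePoint : ∀ p, IsSingularPoint F p → IsRationalDoublePoint F p

/-- The projective line given by the subspace `l` lies on the surface `F = 0`. -/
def IsLineOn {k : Type*} [Field k] (F : MvPolynomial (Fin 4) k)
    (l : Submodule k (Fin 4 → k)) : Prop :=
  Module.finrank k l = 2 ∧ ∀ v ∈ l, eval v F = 0

/-- In the coordinates given by `A`, the line `l` is the line `x₀ = x₁ = 0`. -/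
def IsAdapted {k : Type*} [Field k] (A : GL (Fin 4) k) (l : Submodule k (Fin 4 → k)) : Prop :=
  ∀ v : Fin 4 → k, (A : Matrix (Fin 4) (Fin 4) k).mulVec v ∈ l ↔ v 0 = 0 ∧ v 1 = 0

/-! In the next definitions `G = 0` is a surface containing the line `x₀ = x₁ = 0`. The planes
through this line are `(x₀, x₁) = (a y, b y)` with `[a : b]` in the projective line, and
`y, x₂, x₃` are coordinates on such a plane, in which `y = 0` is the line. In the ring
`MvPolynomial (Fin 5) k` the variables `X 0, …, X 4` stand for `a, b, y, x₂, x₃`.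
In `MvPolynomial (Fin 2) k`, the ring of forms on the line, `X 0, X 1` stand for `x₂, x₃`. -/

/-- The equation of the residual cubic in the plane `[a : b]`, namely `G (a y, b y, x₂, x₃) / y`. -/
def residualCubic {k : Type*} [Field k] (G : MvPolynomial (Fin 4) k) : MvPolynomial (Fin 5) k :=
  divMonomial (bind₁ ![X 0 * X 2, X 1 * X 2, X 3, X 4] G) (Finsupp.single 2 1)

/-- The form `α` on the line: `a α + b β` cuts out the intersection of the line with the residual
cubic in the plane `[a : b]`. -/
def alpha {k : Type*} [Field k] (G : MvPolynomial (Fin 4) k) : MvPolynomial (Fin 2) k :=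
  bind₁ ![1, 0, 0, X 0, X 1] (residualCubic G)

/-- The form `β` on the line: `a α + b β` cuts out the intersection of the line with the residual
cubic in the plane `[a : b]`. -/
def beta {k : Type*} [Field k] (G : MvPolynomial (Fin 4) k) : MvPolynomial (Fin 2) k :=
  bind₁ ![0, 1, 0, X 0, X 1] (residualCubic G)

/-- The hessian of the residual cubic, with respect to the plane coordinates `y, x₂, x₃`. -/
def hessian {k : Type*} [Field k] (G : MvPolynomial (Fin 4) k) : MvPolynomial (Fin 5) k :=
  (Matrix.of fun i j : Fin 3 =>
    pderiv (Fin.natAdd 2 i : Fin 5) (pderiv (Fin.natAdd 2 j : Fin 5) (residualCubic G))).det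

/-- The hessian, restricted to the line `y = 0`, becomes the zero form when the parameter `[a : b]`
is eliminated by means of `a α + b β = 0`, that is, on substituting `[a : b] = [β : -α]`. -/
def HessianVanishes {k : Type*} [Field k] (G : MvPolynomial (Fin 4) k) : Prop :=
  bind₁ ![beta G, -alpha G, 0, X 0, X 1] (hessian G) = 0

/-- The pair of binary forms `f` defines the morphism from the line to the projective line of
planes through it that sends a point to the plane whose residual cubic passes through that point.
This is `[β : -α]` after removal of the common factors of `α` and `β`, so that the morphism is
also defined at the points of the line where the surface is singular. (The strict transform of the
line on the minimal desingularization is isomorphic to the line; this morphism is the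
restriction to it of the elliptic fibration given by the pencil of planes.) -/
def IsInducedMorphism {k : Type*} [Field k] (G : MvPolynomial (Fin 4) k)
    (f : Fin 2 → MvPolynomial (Fin 2) k) : Prop :=
  IsRelPrime (f 0) (f 1) ∧ ∃ h, h ≠ 0 ∧ beta G = h * f 0 ∧ -alpha G = h * f 1

/-- The ramification points of the morphism `[f 0 : f 1]` from the projective line to itself, where
`f` is a pair of coprime binary forms of the same degree: the points `P` such that the form
defining the fibre through `P` vanishes at `P` with multiplicity at least 2. -/
def ramificationPoints {k : Type*} [Field k] (f : Fin 2 → MvPolynomial (Fin 2) k) :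
    Set (Projectivization k (Fin 2 → k)) :=
  {P | (C (P.rep 1) * X 0 - C (P.rep 0) * X 1) ^ 2 ∣
    C (eval P.rep (f 1)) * f 0 - C (eval P.rep (f 0)) * f 1}

/-- The line `l` on the surface `F = 0` has degree `d`: the induced morphism has degree `d`. -/
def HasDegree {k : Type*} [Field k] (F : MvPolynomial (Fin 4) k) (l : Submodule k (Fin 4 → k))
    (d : ℕ) : Prop :=
  ∃ A f, IsAdapted A l ∧ IsInducedMorphism (changeCoords A F) f ∧ ∀ i, (f i).IsHomogeneous d

/-- The morphism induced by the line `l` on the surface `F = 0` has exactly `n` points of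
ramification. -/
def HasRamificationCount {k : Type*} [Field k] (F : MvPolynomial (Fin 4) k)
    (l : Submodule k (Fin 4 → k)) (n : ℕ) : Prop :=
  ∃ A f, IsAdapted A l ∧ IsInducedMorphism (changeCoords A F) f ∧
    (ramificationPoints f).encard = n

/-- The line `l` on the surface `F = 0` is of the second kind. -/
def IsSecondKind {k : Type*} [Field k] (F : MvPolynomial (Fin 4) k)
    (l : Submodule k (Fin 4 → k)) : Prop :=
  (∃ d, 1 ≤ d ∧ HasDegree F l d) ∧ ∃ A, IsAdapted A l ∧ HessianVanishes (changeCoords A F)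

end

end K3Quartic

open MvPolynomial

namespace K3Quartic

noncomputable section

variable {k : Type*} [Field k]

/-! Take coordinates in which `l` is x₀ = x₁ = 0. Degree 3 makes α and β coprime cubics. The
ramification points of the map they define are the zeros of their Wronskian, a binary quartic. If
there are only two of them, Plücker's relation and coprimality force both to be total, so the pencil
spanned by α, β contains two independent cubes (`twoCubes_of_ramificationPoints`). A change of basis
gives α = x₃³, β = x₂³.

Write the equation as x₀x₃³ + x₁x₂³ + a x₂² + b x₂x₃ + c x₃² + d x₂ + e x₃ + g with a, …, g forms in
x₀, x₁. The vanishing of the hessian on l says that x₁ divides a, that x₀ divides c, and that d, e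
are exactly the forms that disappear when the two cubes are completed. This leaves x₀x₃³ + x₁x₂³ + b
x₂x₃ + g (`exists_secondKindQuartic`).

The line `m` meets l at a point [ω : 1], after exchanging the coordinates if necessary. If ω ≠ 0,
the pencil of m contains no two independent cubes (`false_of_general_line`). If ω = 0, the two cubes
and the hessian of m force b = 0 and g = g₀x₀⁴ - v³x₁⁴ with v ≠ 0 (`coeff_of_special_line`).

Finally g₀ ≠ 0, since otherwise [1:0:0:0] is a triple point, and every ADE normal form has order at
most 2 (`not_isK3Quartic_of_triple_point`). A diagonal scaling then yields Schur's quartic.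

The degree, the ramification and the hessian condition may each be witnessed in a different adapted
frame, so the data attached to a line are first shown to transform well under the matrices
preserving x₀ = x₁ = 0. -/

theorem pderiv_bind₁ {σ τ R : Type*} [CommRing R] [Fintype σ] (f : σ → MvPolynomial τ R) (i : τ)
    (p : MvPolynomial σ R) :
    pderiv i (bind₁ f p) = ∑ j, bind₁ f (pderiv j p) * pderiv i (f j) := by
  classical
  induction p using MvPolynomial.induction_on with
  | C a => simp
  | add p q hp hq => simp only [map_add, hp, hq, add_mul, Finset.sum_add_distrib]
  | mul_X p n hp =>
    simp only [map_mul, bind₁_X_right, Derivation.leibniz, hp, pderiv_X, smul_eq_mul, map_add,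
      add_mul, Finset.sum_add_distrib, Finset.mul_sum]
    congr 1
    · rw [Finset.sum_eq_single n]
      · simp
      · intro b _ hb
        simp [hb.symm]
      · simp
    · exact Finset.sum_congr rfl fun j _ => by ring

/-! ### Linear changes of coordinates and adapted frames. -/

theorem changeCoords_changeCoords (A B : GL (Fin 4) k) (F : MvPolynomial (Fin 4) k) :
    changeCoords B (changeCoords A F) = changeCoords (A * B) F := by
  simp only [changeCoords, bind₁_bind₁]
  congr 1
  congr 1
  funext i
  simp only [map_sum, map_mul, bind₁_X_right, algHom_C, algebraMap_eq, Units.val_mul,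
    Matrix.mul_apply, Finset.mul_sum, Finset.sum_mul]
  rw [Finset.sum_comm]
  exact Finset.sum_congr rfl fun j _ => Finset.sum_congr rfl fun l _ => by ring

theorem changeCoords_one (F : MvPolynomial (Fin 4) k) : changeCoords 1 F = F := by
  have : (fun i : Fin 4 => ∑ j, C (((1 : GL (Fin 4) k) : Matrix (Fin 4) (Fin 4) k) i j) * X j)
      = (X : Fin 4 → MvPolynomial (Fin 4) k) := by
    funext i
    rw [Finset.sum_eq_single i] <;> simp +contextual [eq_comm]
  rw [changeCoords, this]
  simp

theorem eval_changeCoords (A : GL (Fin 4) k) (F : MvPolynomial (Fin 4) k) (v : Fin 4 → k) :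
    eval v (changeCoords A F) = eval ((A : Matrix (Fin 4) (Fin 4) k).mulVec v) F := by
  rw [changeCoords, ← aeval_eq_eval, ← aeval_eq_eval, aeval_bind₁]
  simp only [aeval_def, eval₂_eq_eval_map]
  congr 2
  funext i
  simp [Matrix.mulVec, dotProduct]

theorem changeCoords_isHomogeneous (A : GL (Fin 4) k) {F : MvPolynomial (Fin 4) k} {n : ℕ}
    (hF : F.IsHomogeneous n) : (changeCoords A F).IsHomogeneous n := by
  have := hF.aeval (fun i => ∑ j, C ((A : Matrix (Fin 4) (Fin 4) k) i j) * X j) (n := 1)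
    (fun i => IsHomogeneous.sum _ _ _ fun j _ => by
      simpa using (isHomogeneous_C _ _).mul (isHomogeneous_X k j))
  rw [mul_comm, mul_one] at this
  exact this

/-- The matrix `T` maps the line `x₀ = x₁ = 0` to itself. -/
def PreservesLine (T : GL (Fin 4) k) : Prop :=
  T.1 0 2 = 0 ∧ T.1 0 3 = 0 ∧ T.1 1 2 = 0 ∧ T.1 1 3 = 0

theorem IsAdapted.exists_mul {A B : GL (Fin 4) k} {l : Submodule k (Fin 4 → k)}
    (hA : IsAdapted A l) (hB : IsAdapted B l) : ∃ T, PreservesLine T ∧ B = A * T := by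
  refine ⟨A⁻¹ * B, ?_, by group⟩
  have key : ∀ v : Fin 4 → k, v 0 = 0 → v 1 = 0 →
      ((A⁻¹ * B : GL (Fin 4) k) : Matrix (Fin 4) (Fin 4) k).mulVec v 0 = 0 ∧
      ((A⁻¹ * B : GL (Fin 4) k) : Matrix (Fin 4) (Fin 4) k).mulVec v 1 = 0 := by
    intro v h0 h1
    rw [← hA, Matrix.mulVec_mulVec, ← Units.val_mul, mul_inv_cancel_left]
    exact (hB v).2 ⟨h0, h1⟩
  have h2 := key (Pi.single 2 1) (by simp) (by simp)
  have h3 := key (Pi.single 3 1) (by simp) (by simp)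
  simp only [Matrix.mulVec_single_one, Matrix.col_apply] at h2 h3
  exact ⟨h2.1, h3.1, h2.2, h3.2⟩

/-! ### The residual cubic and the forms α, β under a change of frame. -/

/-- The polynomial vanishes on the line `x₀ = x₁ = 0`. -/
def ContainsLine (G : MvPolynomial (Fin 4) k) : Prop :=
  bind₁ ![0, 0, X 0, X 1] G = (0 : MvPolynomial (Fin 2) k)

theorem X_dvd_sub_bind₁ {σ τ : Type*} (i : τ) (f g : σ → MvPolynomial τ k)
    (h : ∀ j, X i ∣ f j - g j) (p : MvPolynomial σ k) : X i ∣ bind₁ f p - bind₁ g p := by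
  induction p using MvPolynomial.induction_on with
  | C a => simp
  | add p q hp hq =>
    rw [map_add, map_add, add_sub_add_comm]
    exact dvd_add hp hq
  | mul_X p n hp =>
    have : bind₁ f (p * X n) - bind₁ g (p * X n)
        = (bind₁ f p - bind₁ g p) * f n + bind₁ g p * (f n - g n) := by
      simp only [map_mul, bind₁_X_right]; ring
    rw [this]
    exact dvd_add (hp.mul_right _) ((h n).mul_left _)

theorem X_mul_residualCubic {G : MvPolynomial (Fin 4) k} (hG : ContainsLine G) :
    X 2 * residualCubic G = bind₁ ![X 0 * X 2, X 1 * X 2, X 3, X 4] G := by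
  have h1 : (X 2 : MvPolynomial (Fin 5) k) ∣ bind₁ ![X 0 * X 2, X 1 * X 2, X 3, X 4] G -
      bind₁ ![0, 0, X 3, X 4] G := by
    apply X_dvd_sub_bind₁
    intro j
    fin_cases j <;> simp
  have h2 : bind₁ ![0, 0, X 3, X 4] G = (0 : MvPolynomial (Fin 5) k) := by
    have := congrArg (bind₁ ![X 3, X 4] : MvPolynomial (Fin 2) k →ₐ[k] MvPolynomial (Fin 5) k) hG
    rw [bind₁_bind₁, map_zero] at this
    refine Eq.trans ?_ this
    congr 2
    funext i
    fin_cases i <;> simp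
  rw [h2, sub_zero] at h1
  obtain ⟨r, hr⟩ := h1
  rw [residualCubic, hr, X_mul_divMonomial]

theorem residualCubic_eq {G : MvPolynomial (Fin 4) k} {R : MvPolynomial (Fin 5) k}
    (h : bind₁ ![X 0 * X 2, X 1 * X 2, X 3, X 4] G = X 2 * R) : residualCubic G = R := by
  rw [residualCubic, h, X_mul_divMonomial]

/-- Differentiating the defining relation of the residual cubic in y replaces division by y with
partial derivatives. Setting y = 0 then identifies α and β with ∂G/∂x₀ and ∂G/∂x₁ on the line. -/
theorem residualCubic_add_X_mul {G : MvPolynomial (Fin 4) k} (hG : ContainsLine G) :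
    residualCubic G + X 2 * pderiv 2 (residualCubic G) =
      bind₁ ![X 0 * X 2, X 1 * X 2, X 3, X 4] (pderiv 0 G) * X 0 +
      bind₁ ![X 0 * X 2, X 1 * X 2, X 3, X 4] (pderiv 1 G) * X 1 := by
  have := congrArg (pderiv (2 : Fin 5)) (X_mul_residualCubic hG)
  rw [pderiv_bind₁] at this
  simp [Fin.sum_univ_four, pderiv_X, Derivation.leibniz] at this
  rw [← this]; ring

theorem alpha_eq {G : MvPolynomial (Fin 4) k} (hG : ContainsLine G) :
    alpha G = bind₁ ![0, 0, X 0, X 1] (pderiv 0 G) := by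
  have := congrArg (bind₁ ![1, 0, 0, X 0, X 1] : MvPolynomial (Fin 5) k →ₐ[k]
    MvPolynomial (Fin 2) k) (residualCubic_add_X_mul hG)
  simp only [map_add, map_mul, bind₁_bind₁, bind₁_X_right] at this
  simp at this
  rw [alpha, this]
  congr 2
  funext i
  fin_cases i <;> simp

theorem beta_eq {G : MvPolynomial (Fin 4) k} (hG : ContainsLine G) :
    beta G = bind₁ ![0, 0, X 0, X 1] (pderiv 1 G) := by
  have := congrArg (bind₁ ![0, 1, 0, X 0, X 1] : MvPolynomial (Fin 5) k →ₐ[k]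
    MvPolynomial (Fin 2) k) (residualCubic_add_X_mul hG)
  simp only [map_add, map_mul, bind₁_bind₁, bind₁_X_right] at this
  simp at this
  rw [beta, this]
  congr 2
  funext i
  fin_cases i <;> simp

/-- The linear substitution with matrix `N` in two variables. -/
def subst₂ (N : Matrix (Fin 2) (Fin 2) k) : MvPolynomial (Fin 2) k →ₐ[k] MvPolynomial (Fin 2) k :=
  bind₁ fun i => C (N i 0) * X 0 + C (N i 1) * X 1

theorem subst₂_subst₂ (N N' : Matrix (Fin 2) (Fin 2) k) (p : MvPolynomial (Fin 2) k) :
    subst₂ N (subst₂ N' p) = subst₂ (N' * N) p := by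
  simp only [subst₂, bind₁_bind₁]
  congr 2
  funext i
  simp [Matrix.mul_apply, Fin.sum_univ_two]
  ring

theorem subst₂_one (p : MvPolynomial (Fin 2) k) : subst₂ 1 p = p := by
  have : (fun i => C ((1 : Matrix (Fin 2) (Fin 2) k) i 0) * X 0 +
      C ((1 : Matrix (Fin 2) (Fin 2) k) i 1) * X 1) = (X : Fin 2 → MvPolynomial (Fin 2) k) := by
    funext i
    match i with
    | 0 => simp
    | 1 => simp
  rw [subst₂, this]
  simp

/-- The block of `T` acting on the parameters of the pencil of planes. -/
def pencilBlock (T : GL (Fin 4) k) : Matrix (Fin 2) (Fin 2) k := !![T.1 0 0, T.1 0 1; T.1 1 0, T.1 1 1]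

/-- The block of `T` acting on the line `x₀ = x₁ = 0`. -/
def lineBlock (T : GL (Fin 4) k) : Matrix (Fin 2) (Fin 2) k := !![T.1 2 2, T.1 2 3; T.1 3 2, T.1 3 3]

theorem PreservesLine.det_eq {T : GL (Fin 4) k} (hT : PreservesLine T) :
    (T : Matrix (Fin 4) (Fin 4) k).det = (pencilBlock T).det * (lineBlock T).det := by
  obtain ⟨h1, h2, h3, h4⟩ := hT
  rw [Matrix.det_succ_row_zero]
  simp [Fin.sum_univ_four, Matrix.det_fin_three, Matrix.det_fin_two, pencilBlock, lineBlock,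
    Fin.succAbove, h1, h2, h3, h4]
  ring

theorem bind₁_zero_zero_changeCoords {T : GL (Fin 4) k} (hT : PreservesLine T)
    (G : MvPolynomial (Fin 4) k) :
    bind₁ ![0, 0, X 0, X 1] (changeCoords T G) =
      subst₂ (lineBlock T) (bind₁ ![0, 0, X 0, X 1] G) := by
  obtain ⟨h1, h2, h3, h4⟩ := hT
  simp only [changeCoords, subst₂, bind₁_bind₁]
  congr 2
  funext i
  fin_cases i <;> simp [Fin.sum_univ_four, lineBlock, h1, h2, h3, h4]

theorem ContainsLine.changeCoords {T : GL (Fin 4) k} (hT : PreservesLine T)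
    {G : MvPolynomial (Fin 4) k} (hG : ContainsLine G) : ContainsLine (changeCoords T G) := by
  rw [ContainsLine, bind₁_zero_zero_changeCoords hT, hG, map_zero]

theorem ContainsLine.bind₁_pderiv_two {G : MvPolynomial (Fin 4) k} (hG : ContainsLine G) :
    bind₁ ![0, 0, X 0, X 1] (pderiv 2 G) = (0 : MvPolynomial (Fin 2) k) := by
  have := congrArg (pderiv (0 : Fin 2)) hG
  rw [pderiv_bind₁] at this
  simpa [Fin.sum_univ_four, pderiv_X] using this

theorem ContainsLine.bind₁_pderiv_three {G : MvPolynomial (Fin 4) k} (hG : ContainsLine G) :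
    bind₁ ![0, 0, X 0, X 1] (pderiv 3 G) = (0 : MvPolynomial (Fin 2) k) := by
  have := congrArg (pderiv (1 : Fin 2)) hG
  rw [pderiv_bind₁] at this
  simpa [Fin.sum_univ_four, pderiv_X] using this

/-- By the chain rule; the derivatives in the directions x₂, x₃ vanish on a line contained in the
surface, so only the first two rows of `T` contribute. -/
theorem bind₁_pderiv_changeCoords {T : GL (Fin 4) k} (hT : PreservesLine T)
    {G : MvPolynomial (Fin 4) k} (hG : ContainsLine G) (i : Fin 4) :
    bind₁ ![0, 0, X 0, X 1] (pderiv i (changeCoords T G)) =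
      C (T.1 0 i) * subst₂ (lineBlock T) (alpha G) + C (T.1 1 i) * subst₂ (lineBlock T) (beta G) := by
  have h : ∀ j, bind₁ ![0, 0, X 0, X 1] (bind₁ (fun i => ∑ j, C (T.1 i j) * X j) (pderiv j G))
      = subst₂ (lineBlock T) (bind₁ ![0, 0, X 0, X 1] (pderiv j G)) :=
    fun j => bind₁_zero_zero_changeCoords hT (pderiv j G)
  have hd : ∀ j, pderiv i (∑ j', C (T.1 j j') * X j' : MvPolynomial (Fin 4) k) = C (T.1 j i) := by
    intro j
    rw [map_sum, Finset.sum_eq_single i]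
    · simp
    · intro b _ hb
      simp [hb]
    · simp
  rw [K3Quartic.changeCoords, pderiv_bind₁, map_sum]
  simp only [map_mul, h, hd, bind₁_C_right]
  rw [Fin.sum_univ_four, hG.bind₁_pderiv_two, hG.bind₁_pderiv_three, ← alpha_eq hG, ← beta_eq hG]
  simp only [map_zero, zero_mul, add_zero]
  ring

theorem alpha_changeCoords {T : GL (Fin 4) k} (hT : PreservesLine T)
    {G : MvPolynomial (Fin 4) k} (hG : ContainsLine G) :
    alpha (changeCoords T G) =
      C (T.1 0 0) * subst₂ (lineBlock T) (alpha G) + C (T.1 1 0) * subst₂ (lineBlock T) (beta G) := by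
  rw [alpha_eq (hG.changeCoords hT), bind₁_pderiv_changeCoords hT hG]

theorem beta_changeCoords {T : GL (Fin 4) k} (hT : PreservesLine T)
    {G : MvPolynomial (Fin 4) k} (hG : ContainsLine G) :
    beta (changeCoords T G) =
      C (T.1 0 1) * subst₂ (lineBlock T) (alpha G) + C (T.1 1 1) * subst₂ (lineBlock T) (beta G) := by
  rw [beta_eq (hG.changeCoords hT), bind₁_pderiv_changeCoords hT hG]

theorem PreservesLine.det_pencilBlock_ne_zero {T : GL (Fin 4) k} (hT : PreservesLine T) :
    (pencilBlock T).det ≠ 0 := fun h => by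
  have := hT.det_eq
  rw [h, zero_mul] at this
  exact (Matrix.isUnit_iff_isUnit_det _ |>.1 T.isUnit).ne_zero this

theorem PreservesLine.det_lineBlock_ne_zero {T : GL (Fin 4) k} (hT : PreservesLine T) :
    (lineBlock T).det ≠ 0 := fun h => by
  have := hT.det_eq
  rw [h, mul_zero] at this
  exact (Matrix.isUnit_iff_isUnit_det _ |>.1 T.isUnit).ne_zero this

/-! ### Invariance of the hessian condition. -/

/-- The substitution in the parameters of the pencil and the coordinates on its planes that
corresponds to the change of coordinates `T`; the factor `δ` is moved from the parameters to the
coordinate `y`. -/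
def pencilSubst (T : GL (Fin 4) k) (δ : k) : Fin 5 → MvPolynomial (Fin 5) k :=
  ![C (δ⁻¹ * T.1 0 0) * X 0 + C (δ⁻¹ * T.1 0 1) * X 1,
    C (δ⁻¹ * T.1 1 0) * X 0 + C (δ⁻¹ * T.1 1 1) * X 1,
    C δ * X 2,
    (C (T.1 2 0) * X 0 + C (T.1 2 1) * X 1) * X 2 + C (T.1 2 2) * X 3 + C (T.1 2 3) * X 4,
    (C (T.1 3 0) * X 0 + C (T.1 3 1) * X 1) * X 2 + C (T.1 3 2) * X 3 + C (T.1 3 3) * X 4]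

theorem residualCubic_changeCoords {T : GL (Fin 4) k} (hT : PreservesLine T)
    {G : MvPolynomial (Fin 4) k} (hG : ContainsLine G) {δ : k} (hδ : δ ≠ 0) :
    residualCubic (changeCoords T G) = C δ * bind₁ (pencilSubst T δ) (residualCubic G) := by
  apply residualCubic_eq
  have h1 := congrArg (bind₁ (pencilSubst T δ)) (X_mul_residualCubic hG)
  rw [map_mul, bind₁_X_right] at h1
  have h2 : pencilSubst T δ 2 = C δ * X 2 := rfl
  rw [h2] at h1
  have h3 : (C δ : MvPolynomial (Fin 5) k) * C δ⁻¹ = 1 := by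
    rw [← C_mul, mul_inv_cancel₀ hδ, C_1]
  rw [mul_left_comm, ← mul_assoc, h1, changeCoords, bind₁_bind₁, bind₁_bind₁]
  obtain ⟨t1, t2, t3, t4⟩ := hT
  congr 2
  funext i
  fin_cases i
  · simp [Fin.sum_univ_four, pencilSubst, t1, t2]
    linear_combination (-(C (T.1 0 0) * X 0 * X 2 + C (T.1 0 1) * X 1 * X 2)) * h3
  · simp [Fin.sum_univ_four, pencilSubst, t3, t4]
    linear_combination (-(C (T.1 1 0) * X 0 * X 2 + C (T.1 1 1) * X 1 * X 2)) * h3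
  · simp [Fin.sum_univ_four, pencilSubst]
    ring
  · simp [Fin.sum_univ_four, pencilSubst]
    ring

/-- The jacobian matrix of `pencilSubst T δ` with respect to the coordinates `y, x₂, x₃`. -/
def pencilJacobian (T : GL (Fin 4) k) (δ : k) : Matrix (Fin 3) (Fin 3) (MvPolynomial (Fin 5) k) :=
  !![C δ, 0, 0;
    C (T.1 2 0) * X 0 + C (T.1 2 1) * X 1, C (T.1 2 2), C (T.1 2 3);
    C (T.1 3 0) * X 0 + C (T.1 3 1) * X 1, C (T.1 3 2), C (T.1 3 3)]

theorem pderiv_pencilSubst (T : GL (Fin 4) k) (δ : k) (i j : Fin 3) :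
    pderiv (Fin.natAdd 2 j : Fin 5) (pencilSubst T δ (Fin.natAdd 2 i : Fin 5)) =
      pencilJacobian T δ i j := by
  fin_cases i <;> fin_cases j <;>
    simp [pencilSubst, pencilJacobian, pderiv_X, Fin.natAdd]

theorem pderiv_bind₁_pencilSubst (T : GL (Fin 4) k) (δ : k) (p : MvPolynomial (Fin 5) k)
    (j : Fin 3) :
    pderiv (Fin.natAdd 2 j : Fin 5) (bind₁ (pencilSubst T δ) p) =
      ∑ i : Fin 3, bind₁ (pencilSubst T δ) (pderiv (Fin.natAdd 2 i : Fin 5) p) *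
        pencilJacobian T δ i j := by
  have h0 : pderiv (Fin.natAdd 2 j : Fin 5) (pencilSubst T δ 0) = 0 := by
    fin_cases j <;> simp [pencilSubst, pderiv_X, Fin.natAdd]
  have h1 : pderiv (Fin.natAdd 2 j : Fin 5) (pencilSubst T δ 1) = 0 := by
    fin_cases j <;> simp [pencilSubst, pderiv_X, Fin.natAdd]
  rw [pderiv_bind₁]
  simp only [← pderiv_pencilSubst]
  rw [Fin.sum_univ_five, Fin.sum_univ_three, h0, h1]
  simp only [mul_zero, zero_add]
  rfl

theorem pderiv_pencilJacobian (T : GL (Fin 4) k) (δ : k) (i j l : Fin 3) :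
    pderiv (Fin.natAdd 2 l : Fin 5) (pencilJacobian T δ i j) = 0 := by
  fin_cases i <;> fin_cases j <;> fin_cases l <;>
    simp [pencilJacobian, pderiv_X, Fin.natAdd]

/-- The substitution is linear in y, x₂, x₃ with jacobian J depending only on a, b. Hence the matrix
of second derivatives changes by the congruence H ↦ JᵀHJ, up to the scalar δ, and the determinant
picks up δ³ (det J)². -/
theorem hessian_changeCoords {T : GL (Fin 4) k} (hT : PreservesLine T)
    {G : MvPolynomial (Fin 4) k} (hG : ContainsLine G) {δ : k} (hδ : δ ≠ 0) :
    ∃ c : MvPolynomial (Fin 5) k,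
      hessian (changeCoords T G) = c * bind₁ (pencilSubst T δ) (hessian G) := by
  set H : Matrix (Fin 3) (Fin 3) (MvPolynomial (Fin 5) k) := Matrix.of fun i j : Fin 3 =>
    pderiv (Fin.natAdd 2 i : Fin 5) (pderiv (Fin.natAdd 2 j : Fin 5) (residualCubic G)) with hH
  have key : (Matrix.of fun i j : Fin 3 => pderiv (Fin.natAdd 2 i : Fin 5)
      (pderiv (Fin.natAdd 2 j : Fin 5) (residualCubic (changeCoords T G)))) =
      (C δ : MvPolynomial (Fin 5) k) • ((pencilJacobian T δ).transpose *
        (bind₁ (pencilSubst T δ)).toRingHom.mapMatrix H * pencilJacobian T δ) := by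
    have hmap : ∀ a b, (bind₁ (pencilSubst T δ)).toRingHom.mapMatrix H a b =
        bind₁ (pencilSubst T δ) (pderiv (Fin.natAdd 2 a : Fin 5)
          (pderiv (Fin.natAdd 2 b : Fin 5) (residualCubic G))) := fun a b => rfl
    refine Matrix.ext fun i j => ?_
    rw [Matrix.of_apply, residualCubic_changeCoords hT hG hδ, pderiv_C_mul, pderiv_C_mul,
      pderiv_bind₁_pencilSubst, map_sum, Matrix.smul_apply, Matrix.mul_apply, smul_eq_mul]
    refine congrArg (C δ * ·) (Finset.sum_congr rfl fun a _ => ?_)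
    rw [Derivation.leibniz, pderiv_pencilJacobian, smul_zero, zero_add,
      pderiv_bind₁_pencilSubst, smul_eq_mul, Matrix.mul_apply, mul_comm]
    refine congrArg (· * pencilJacobian T δ a j) (Finset.sum_congr rfl fun b _ => ?_)
    rw [hmap, Matrix.transpose_apply, mul_comm]
  refine ⟨C δ ^ 3 * (pencilJacobian T δ).det ^ 2, ?_⟩
  have hdet : (bind₁ (pencilSubst T δ)) (hessian G) =
      ((bind₁ (pencilSubst T δ)).toRingHom.mapMatrix H).det :=
    RingHom.map_det (bind₁ (pencilSubst T δ)).toRingHom H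
  rw [hessian, key, Matrix.det_smul, Matrix.det_mul, Matrix.det_mul, Matrix.det_transpose, hdet,
    Fintype.card_fin]
  ring

theorem HessianVanishes.changeCoords {T : GL (Fin 4) k} (hT : PreservesLine T)
    {G : MvPolynomial (Fin 4) k} (hG : ContainsLine G) (h : HessianVanishes G) :
    HessianVanishes (changeCoords T G) := by
  -- Taking δ to be the determinant of the pencil block makes the substitution carry the new pair
  -- (β, -α) exactly to the old one, by Cramer's rule.
  have hδ := hT.det_pencilBlock_ne_zero
  obtain ⟨c, hc⟩ := hessian_changeCoords hT hG hδ
  have h' := congrArg (subst₂ (lineBlock T)) h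
  rw [HessianVanishes, hc, map_mul, bind₁_bind₁]
  convert mul_zero _
  rw [map_zero, subst₂, bind₁_bind₁] at h'
  refine Eq.trans ?_ h'
  have h3 : (C (pencilBlock T).det : MvPolynomial (Fin 2) k) * C (pencilBlock T).det⁻¹ = 1 := by
    rw [← C_mul, mul_inv_cancel₀ hδ, C_1]
  have h4 : (C (pencilBlock T).det : MvPolynomial (Fin 2) k) =
      C (T.1 0 0) * C (T.1 1 1) - C (T.1 0 1) * C (T.1 1 0) := by
    simp [pencilBlock, Matrix.det_fin_two]
  congr 2
  funext i
  change _ = subst₂ (lineBlock T) _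
  fin_cases i
  · simp [pencilSubst, alpha_changeCoords hT hG, beta_changeCoords hT hG]
    linear_combination subst₂ (lineBlock T) (beta G) * (h3 - C (pencilBlock T).det⁻¹ * h4)
  · simp [pencilSubst, alpha_changeCoords hT hG, beta_changeCoords hT hG]
    linear_combination subst₂ (lineBlock T) (alpha G) * (-h3 + C (pencilBlock T).det⁻¹ * h4)
  · simp [pencilSubst]
  · simp [pencilSubst, subst₂, lineBlock]
  · simp [pencilSubst, subst₂, lineBlock]

/-! ### Binary cubics and cubes in their pencils. -/

theorem isHomogeneous_eq_sum {d n : ℕ} {F : MvPolynomial (Fin d) k} (hF : F.IsHomogeneous n) :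
    ∃ c : (Fin d → ℕ) → k,
      F = ∑ s ∈ Finset.Nat.antidiagonalTuple d n, C (c s) * ∏ i, X i ^ s i := by
  refine ⟨fun s => coeff (Finsupp.equivFunOnFinite.symm s) F, ?_⟩
  have h : ∀ s : Fin d → ℕ, C (coeff (Finsupp.equivFunOnFinite.symm s) F) * ∏ i, X i ^ s i =
      monomial (Finsupp.equivFunOnFinite.symm s) (coeff (Finsupp.equivFunOnFinite.symm s) F) := by
    intro s
    rw [monomial_eq, Finsupp.prod_fintype _ _ (fun i => pow_zero _)]
    rfl
  simp only [h]
  ext m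
  rw [coeff_sum]
  simp only [coeff_monomial]
  rw [Finset.sum_eq_single (m : Fin d → ℕ)]
  · simp
  · intro s _ hs
    rw [if_neg]
    rintro rfl
    exact hs rfl
  · intro hm
    simp only [Finsupp.equivFunOnFinite_symm_coe, ↓reduceIte]
    by_contra hne
    refine hm ?_
    rw [Finset.Nat.mem_antidiagonalTuple, ← hF hne]
    simp [Finsupp.weight_apply, Finsupp.sum_fintype]

/-- The binary cubic form with the given coefficients. -/
def binaryCubic (a : Fin 4 → k) : MvPolynomial (Fin 2) k :=
  C (a 0) * X 0 ^ 3 + C (a 1) * (X 0 ^ 2 * X 1) + C (a 2) * (X 0 * X 1 ^ 2) + C (a 3) * X 1 ^ 3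

theorem exists_eq_binaryCubic {f : MvPolynomial (Fin 2) k} (hf : f.IsHomogeneous 3) :
    ∃ a, f = binaryCubic a := by
  obtain ⟨c, hc⟩ := isHomogeneous_eq_sum hf
  refine ⟨![c ![3, 0], c ![2, 1], c ![1, 2], c ![0, 3]], ?_⟩
  have : Finset.Nat.antidiagonalTuple 2 3 = {![3, 0], ![2, 1], ![1, 2], ![0, 3]} := by decide
  rw [hc, this, Finset.sum_insert (by decide), Finset.sum_insert (by decide),
    Finset.sum_insert (by decide), Finset.sum_singleton]
  simp [binaryCubic, Fin.prod_univ_two]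
  ring

theorem eval_subst₂ (N : Matrix (Fin 2) (Fin 2) k) (v : Fin 2 → k) (f : MvPolynomial (Fin 2) k) :
    eval v (subst₂ N f) = eval (N.mulVec v) f := by
  rw [subst₂, ← aeval_eq_eval, ← aeval_eq_eval, aeval_bind₁]
  congr 2
  funext i
  simp [Matrix.mulVec, dotProduct, Fin.sum_univ_two]

theorem subst₂_C (N : Matrix (Fin 2) (Fin 2) k) (a : k) : subst₂ N (C a) = C a :=
  bind₁_C_right _ _

theorem subst₂_inv_subst₂ {N : Matrix (Fin 2) (Fin 2) k} (hN : N.det ≠ 0)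
    (f : MvPolynomial (Fin 2) k) : subst₂ N⁻¹ (subst₂ N f) = f := by
  rw [subst₂_subst₂, Matrix.mul_nonsing_inv _ hN.isUnit, subst₂_one]

theorem subst₂_subst₂_inv {N : Matrix (Fin 2) (Fin 2) k} (hN : N.det ≠ 0)
    (f : MvPolynomial (Fin 2) k) : subst₂ N (subst₂ N⁻¹ f) = f := by
  rw [subst₂_subst₂, Matrix.nonsing_inv_mul _ hN.isUnit, subst₂_one]

theorem isRelPrime_subst₂ {N : Matrix (Fin 2) (Fin 2) k} (hN : N.det ≠ 0)
    {f g : MvPolynomial (Fin 2) k} (h : IsRelPrime f g) :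
    IsRelPrime (subst₂ N f) (subst₂ N g) := by
  intro d hf hg
  have hf' := map_dvd (subst₂ N⁻¹) hf
  have hg' := map_dvd (subst₂ N⁻¹) hg
  rw [subst₂_inv_subst₂ hN] at hf' hg'
  have := (h hf' hg').map (subst₂ N)
  rwa [subst₂_subst₂_inv hN] at this

theorem isRelPrime_combination {M : Matrix (Fin 2) (Fin 2) k} (hM : M.det ≠ 0)
    {f g : MvPolynomial (Fin 2) k} (h : IsRelPrime f g) :
    IsRelPrime (C (M 0 0) * f + C (M 1 0) * g) (C (M 0 1) * f + C (M 1 1) * g) := by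
  intro d h1 h2
  have hu : IsUnit (C M.det : MvPolynomial (Fin 2) k) := hM.isUnit.map C
  refine h ?_ ?_
  · refine (hu.dvd_mul_left).1 (?_ : d ∣ C M.det * f)
    have : C M.det * f = C (M 1 1) * (C (M 0 0) * f + C (M 1 0) * g)
        - C (M 1 0) * (C (M 0 1) * f + C (M 1 1) * g) := by
      rw [Matrix.det_fin_two]; simp only [C_sub, C_mul]; ring
    rw [this]
    exact dvd_sub (h1.mul_left _) (h2.mul_left _)
  · refine (hu.dvd_mul_left).1 (?_ : d ∣ C M.det * g)
    have : C M.det * g = C (M 0 0) * (C (M 0 1) * f + C (M 1 1) * g)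
        - C (M 0 1) * (C (M 0 0) * f + C (M 1 0) * g) := by
      rw [Matrix.det_fin_two]; simp only [C_sub, C_mul]; ring
    rw [this]
    exact dvd_sub (h2.mul_left _) (h1.mul_left _)

/-- The pencil of binary cubics spanned by `f` and `g` contains the cube of the linear form with
coefficients `p`. -/
def CubeInPencil (f g : MvPolynomial (Fin 2) k) (p : Fin 2 → k) : Prop :=
  ∃ a b, C a * f + C b * g = (C (p 0) * X 0 + C (p 1) * X 1) ^ 3

/-- The pencil spanned by `f` and `g` contains the cubes of two independent linear forms. -/
def TwoCubes (f g : MvPolynomial (Fin 2) k) : Prop :=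
  ∃ p q : Fin 2 → k, p 0 * q 1 - p 1 * q 0 ≠ 0 ∧ CubeInPencil f g p ∧ CubeInPencil f g q

theorem CubeInPencil.subst₂ {f g : MvPolynomial (Fin 2) k} {p : Fin 2 → k}
    (h : CubeInPencil f g p) (N : Matrix (Fin 2) (Fin 2) k) :
    CubeInPencil (subst₂ N f) (subst₂ N g) (Matrix.vecMul p N) := by
  obtain ⟨a, b, h⟩ := h
  refine ⟨a, b, ?_⟩
  have := congrArg (K3Quartic.subst₂ N) h
  simp only [map_add, map_mul, map_pow] at this
  simp only [K3Quartic.subst₂, bind₁_C_right, bind₁_X_right] at this ⊢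
  rw [this]
  simp [Matrix.vecMul, dotProduct, Fin.sum_univ_two]
  ring

theorem CubeInPencil.combination {f g : MvPolynomial (Fin 2) k} {p : Fin 2 → k}
    (h : CubeInPencil f g p) {M : Matrix (Fin 2) (Fin 2) k} (hM : M.det ≠ 0) :
    CubeInPencil (C (M 0 0) * f + C (M 1 0) * g) (C (M 0 1) * f + C (M 1 1) * g) p := by
  obtain ⟨a, b, h⟩ := h
  refine ⟨(a * M 1 1 - b * M 0 1) / M.det, (b * M 0 0 - a * M 1 0) / M.det, ?_⟩
  rw [← h]
  have h1 : (C M.det⁻¹ : MvPolynomial (Fin 2) k) *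
      (C (M 0 0) * C (M 1 1) - C (M 0 1) * C (M 1 0)) = 1 := by
    rw [← C_mul, ← C_mul, ← C_sub, ← C_mul, ← Matrix.det_fin_two, inv_mul_cancel₀ hM, C_1]
  simp only [div_eq_mul_inv, C_mul, C_sub]
  linear_combination (C a * f + C b * g) * h1

theorem TwoCubes.subst₂ {f g : MvPolynomial (Fin 2) k} (h : TwoCubes f g)
    {N : Matrix (Fin 2) (Fin 2) k} (hN : N.det ≠ 0) : TwoCubes (subst₂ N f) (subst₂ N g) := by
  obtain ⟨p, q, hpq, hp, hq⟩ := h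
  refine ⟨_, _, ?_, hp.subst₂ N, hq.subst₂ N⟩
  convert mul_ne_zero hpq hN using 1
  simp [Matrix.vecMul, dotProduct, Fin.sum_univ_two, Matrix.det_fin_two]
  ring

theorem TwoCubes.combination {f g : MvPolynomial (Fin 2) k} (h : TwoCubes f g)
    {M : Matrix (Fin 2) (Fin 2) k} (hM : M.det ≠ 0) :
    TwoCubes (C (M 0 0) * f + C (M 1 0) * g) (C (M 0 1) * f + C (M 1 1) * g) := by
  obtain ⟨p, q, hpq, hp, hq⟩ := h
  exact ⟨p, q, hpq, hp.combination hM, hq.combination hM⟩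

theorem TwoCubes.changeCoords {T : GL (Fin 4) k} (hT : PreservesLine T)
    {G : MvPolynomial (Fin 4) k} (hG : ContainsLine G) (h : TwoCubes (alpha G) (beta G)) :
    TwoCubes (alpha (changeCoords T G)) (beta (changeCoords T G)) := by
  rw [alpha_changeCoords hT hG, beta_changeCoords hT hG]
  exact (h.subst₂ hT.det_lineBlock_ne_zero).combination (M := pencilBlock T)
    hT.det_pencilBlock_ne_zero

theorem isRelPrime_alpha_beta_changeCoords {T : GL (Fin 4) k} (hT : PreservesLine T)
    {G : MvPolynomial (Fin 4) k} (hG : ContainsLine G) (h : IsRelPrime (alpha G) (beta G)) :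
    IsRelPrime (alpha (changeCoords T G)) (beta (changeCoords T G)) := by
  rw [alpha_changeCoords hT hG, beta_changeCoords hT hG]
  exact isRelPrime_combination (M := pencilBlock T) hT.det_pencilBlock_ne_zero
    (isRelPrime_subst₂ hT.det_lineBlock_ne_zero h)

/-! ### Ramification of a pencil of binary cubics. -/

/-- The point `v` is a ramification point of `[f 0 : f 1]`. -/
def IsRamified (f : Fin 2 → MvPolynomial (Fin 2) k) (v : Fin 2 → k) : Prop :=
  (C (v 1) * X 0 - C (v 0) * X 1) ^ 2 ∣ C (eval v (f 1)) * f 0 - C (eval v (f 0)) * f 1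

/-- Frees `ramificationPoints` from the chosen representatives of projective points. -/
theorem isRamified_smul {f : Fin 2 → MvPolynomial (Fin 2) k} (hf : ∀ i, (f i).IsHomogeneous 3)
    {c : k} (hc : c ≠ 0) (v : Fin 2 → k) : IsRamified f (c • v) ↔ IsRamified f v := by
  have h : ∀ i, eval (c • v) (f i) = c ^ 3 * eval v (f i) := by
    intro i
    obtain ⟨a, ha⟩ := exists_eq_binaryCubic (hf i)
    rw [ha]
    simp [binaryCubic]
    ring
  have hu : ∀ n, IsUnit (C (c ^ n) : MvPolynomial (Fin 2) k) := fun n =>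
    (pow_ne_zero n hc).isUnit.map C
  have e1 : (C ((c • v) 1) * X 0 - C ((c • v) 0) * X 1 : MvPolynomial (Fin 2) k) ^ 2 =
      C (c ^ 2) * (C (v 1) * X 0 - C (v 0) * X 1) ^ 2 := by
    simp; ring
  have e2 : C (eval (c • v) (f 1)) * f 0 - C (eval (c • v) (f 0)) * f 1 =
      C (c ^ 3) * (C (eval v (f 1)) * f 0 - C (eval v (f 0)) * f 1) := by
    rw [h, h]; simp; ring
  rw [IsRamified, e1, e2, (hu 2).mul_left_dvd, (hu 3).dvd_mul_left, IsRamified]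

theorem mk_mem_ramificationPoints {f : Fin 2 → MvPolynomial (Fin 2) k}
    (hf : ∀ i, (f i).IsHomogeneous 3) {v : Fin 2 → k} (hv : v ≠ 0) :
    Projectivization.mk k v hv ∈ ramificationPoints f ↔ IsRamified f v := by
  obtain ⟨a, ha⟩ := Projectivization.exists_smul_eq_mk_rep k v hv
  rw [← isRamified_smul hf a.ne_zero, IsRamified, ← Units.smul_def, ha]
  rfl

theorem isRamified_subst₂ {f : Fin 2 → MvPolynomial (Fin 2) k} {v : Fin 2 → k}
    {N : Matrix (Fin 2) (Fin 2) k} (hN : N.det ≠ 0) (h : IsRamified f (N.mulVec v)) :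
    IsRamified (fun i => subst₂ N (f i)) v := by
  have h' := map_dvd (subst₂ N) h
  have hu : IsUnit (C (N.det ^ 2) : MvPolynomial (Fin 2) k) := (pow_ne_zero 2 hN).isUnit.map C
  have e : subst₂ N ((C (N.mulVec v 1) * X 0 - C (N.mulVec v 0) * X 1) ^ 2) =
      C (N.det ^ 2) * (C (v 1) * X 0 - C (v 0) * X 1) ^ 2 := by
    simp [subst₂, Matrix.mulVec, dotProduct, Fin.sum_univ_two, Matrix.det_fin_two]
    ring
  rw [e, hu.mul_left_dvd] at h'
  simp only [map_sub, map_mul, subst₂_C] at h'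
  simpa only [IsRamified, eval_subst₂] using h'

theorem isRamified_subst₂_iff {f : Fin 2 → MvPolynomial (Fin 2) k} {v : Fin 2 → k}
    {N : Matrix (Fin 2) (Fin 2) k} (hN : N.det ≠ 0) :
    IsRamified (fun i => subst₂ N (f i)) v ↔ IsRamified f (N.mulVec v) := by
  refine ⟨fun h => ?_, isRamified_subst₂ hN⟩
  have hN' : N⁻¹.det ≠ 0 := by
    rw [Matrix.det_nonsing_inv, Ring.inverse_eq_inv']; exact inv_ne_zero hN
  have hv : v = N⁻¹.mulVec (N.mulVec v) := by
    rw [Matrix.mulVec_mulVec, Matrix.nonsing_inv_mul _ hN.isUnit, Matrix.one_mulVec]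
  rw [hv] at h
  simpa only [subst₂_inv_subst₂ hN] using isRamified_subst₂ hN' h

theorem IsRamified.wedge_eq_zero_left {a b : Fin 4 → k}
    (h : IsRamified ![binaryCubic a, binaryCubic b] ![1, 0]) : a 0 * b 1 - a 1 * b 0 = 0 := by
  obtain ⟨r, hr⟩ := h
  have := congrArg (fun p => eval ![1, 0] (pderiv 1 p)) hr
  simp [binaryCubic, pderiv_X, Derivation.leibniz, Derivation.leibniz_pow] at this
  linear_combination -this

theorem IsRamified.wedge_eq_zero_right {a b : Fin 4 → k}
    (h : IsRamified ![binaryCubic a, binaryCubic b] ![0, 1]) : a 2 * b 3 - a 3 * b 2 = 0 := by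
  obtain ⟨r, hr⟩ := h
  have := congrArg (fun p => eval ![0, 1] (pderiv 0 p)) hr
  simp [binaryCubic, pderiv_X, Derivation.leibniz, Derivation.leibniz_pow] at this
  linear_combination this

/-- With pᵢⱼ = aᵢbⱼ - aⱼbᵢ, the Wronskian of the two cubics at [t : 1] is p₀₁t⁴ + 2p₀₂t³ + (3p₀₃ +
p₁₂)t² + 2p₁₃t + p₂₃. When p₀₁ = p₂₃ = 0 it is t times the quadratic in `ht`; its vanishing makes t
a double root of the fibre form. -/
theorem isRamified_of_wedge {a b : Fin 4 → k} {t : k}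
    (h01 : a 0 * b 1 - a 1 * b 0 = 0) (h23 : a 2 * b 3 - a 3 * b 2 = 0)
    (ht : 2 * (a 0 * b 2 - a 2 * b 0) * t ^ 2 +
      (3 * (a 0 * b 3 - a 3 * b 0) + (a 1 * b 2 - a 2 * b 1)) * t +
      2 * (a 1 * b 3 - a 3 * b 1) = 0) :
    IsRamified ![binaryCubic a, binaryCubic b] ![t, 1] := by
  set u := a 0 * t ^ 3 + a 1 * t ^ 2 + a 2 * t + a 3 with hu
  set v := b 0 * t ^ 3 + b 1 * t ^ 2 + b 2 * t + b 3 with hv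
  have e2 : (v * a 2 - u * b 2) = (v * a 0 - u * b 0) * t ^ 2
      - 2 * t * ((v * a 1 - u * b 1) + 2 * (v * a 0 - u * b 0) * t) := by
    rw [hu, hv]
    linear_combination t * ht + t ^ 4 * h01 + h23
  have e3 : (v * a 3 - u * b 3) = t ^ 2 * ((v * a 1 - u * b 1) + 2 * (v * a 0 - u * b 0) * t) := by
    rw [hu, hv]
    linear_combination -t ^ 2 * ht - t ^ 5 * h01 - t * h23
  refine ⟨C (v * a 0 - u * b 0) * X 0 + C ((v * a 1 - u * b 1) + 2 * (v * a 0 - u * b 0) * t) * X 1,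
    ?_⟩
  have e2' := congrArg (C : k → MvPolynomial (Fin 2) k) e2
  have e3' := congrArg (C : k → MvPolynomial (Fin 2) k) e3
  have hu' : eval ![t, 1] (binaryCubic a) = u := by simp [binaryCubic, hu]
  have hv' : eval ![t, 1] (binaryCubic b) = v := by simp [binaryCubic, hv]
  simp only [Matrix.cons_val_zero, Matrix.cons_val_one, hu', hv']
  simp only [C_add, C_sub, C_mul, C_pow] at e2' e3'
  have h2 : (C 2 : MvPolynomial (Fin 2) k) = 2 := rfl
  simp only [binaryCubic, C_add, C_sub, C_mul, C_1, h2] at e2' e3' ⊢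
  linear_combination X 0 * X 1 ^ 2 * e2' + X 1 ^ 3 * e3'

theorem not_isUnit_X {σ : Type*} (i : σ) : ¬ IsUnit (X i : MvPolynomial σ k) := fun h => by
  have := h.map (eval (0 : σ → k))
  simp at this

/-- The quadratic left over from the Wronskian has no nonzero root in an algebraically closed field,
so it is a single monomial. Plücker's relation and coprimality exclude every monomial but the middle
one, and then only p₀₃ survives among the minors. -/
theorem binaryCubic_wedge {a b : Fin 4 → k} (h2 : (2 : k) ≠ 0) (h3 : (3 : k) ≠ 0)
    (hrel : IsRelPrime (binaryCubic a) (binaryCubic b))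
    (h10 : IsRamified ![binaryCubic a, binaryCubic b] ![1, 0])
    (h01 : IsRamified ![binaryCubic a, binaryCubic b] ![0, 1])
    (hne : ∀ t, t ≠ 0 → ¬ IsRamified ![binaryCubic a, binaryCubic b] ![t, 1]) [IsAlgClosed k] :
    a 0 * b 3 - a 3 * b 0 ≠ 0 ∧ a 1 = 0 ∧ a 2 = 0 ∧ b 1 = 0 ∧ b 2 = 0 := by
  have p01 := h10.wedge_eq_zero_left
  have p23 := h01.wedge_eq_zero_right
  have hroot : ∀ t, t ≠ 0 → 2 * (a 0 * b 2 - a 2 * b 0) * t ^ 2 +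
      (3 * (a 0 * b 3 - a 3 * b 0) + (a 1 * b 2 - a 2 * b 1)) * t +
      2 * (a 1 * b 3 - a 3 * b 1) ≠ 0 := fun t ht h => hne t ht (isRamified_of_wedge p01 p23 h)
  have e0 : ¬ (a 0 = 0 ∧ b 0 = 0) := by
    rintro ⟨ha, hb⟩
    refine not_isUnit_X (1 : Fin 2) (hrel ?_ ?_ : IsUnit (X 1 : MvPolynomial (Fin 2) k))
    · exact ⟨C (a 1) * X 0 ^ 2 + C (a 2) * (X 0 * X 1) + C (a 3) * X 1 ^ 2, by
        rw [binaryCubic, ha, C_0]; ring⟩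
    · exact ⟨C (b 1) * X 0 ^ 2 + C (b 2) * (X 0 * X 1) + C (b 3) * X 1 ^ 2, by
        rw [binaryCubic, hb, C_0]; ring⟩
  have e3 : ¬ (a 3 = 0 ∧ b 3 = 0) := by
    rintro ⟨ha, hb⟩
    refine not_isUnit_X (0 : Fin 2) (hrel ?_ ?_ : IsUnit (X 0 : MvPolynomial (Fin 2) k))
    · exact ⟨C (a 0) * X 0 ^ 2 + C (a 1) * (X 0 * X 1) + C (a 2) * X 1 ^ 2, by
        rw [binaryCubic, ha, C_0]; ring⟩
    · exact ⟨C (b 0) * X 0 ^ 2 + C (b 1) * (X 0 * X 1) + C (b 2) * X 1 ^ 2, by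
        rw [binaryCubic, hb, C_0]; ring⟩
  -- two independent vectors orthogonal to a third one
  have indep : ∀ x y x' y' z w : k, x * y' - x' * y ≠ 0 → z * y - x * w = 0 → z * y' - x' * w = 0 →
      z = 0 ∧ w = 0 := by
    intro x y x' y' z w h hz hw
    constructor
    · refine (mul_eq_zero.1 (?_ : (x * y' - x' * y) * z = 0)).resolve_left h
      linear_combination x * hw - x' * hz
    · refine (mul_eq_zero.1 (?_ : (x * y' - x' * y) * w = 0)).resolve_left h
      linear_combination y * hw - y' * hz
  set P := a 0 * b 2 - a 2 * b 0 with hP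
  set Q := 3 * (a 0 * b 3 - a 3 * b 0) + (a 1 * b 2 - a 2 * b 1) with hQ
  set R := a 1 * b 3 - a 3 * b 1 with hR
  have plucker : P * R = (a 0 * b 3 - a 3 * b 0) * (a 1 * b 2 - a 2 * b 1) := by
    rw [hP, hR]; linear_combination (a 2 * b 3 - a 3 * b 2) * p01
  by_cases hP0 : P = 0
  · by_cases hR0 : R = 0
    · have hQ0 : Q ≠ 0 := by
        intro hQ0
        exact hroot 1 one_ne_zero (by rw [hP0, hQ0, hR0]; ring)
      have hor : (a 0 * b 3 - a 3 * b 0) = 0 ∨ (a 1 * b 2 - a 2 * b 1) = 0 := by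
        rw [← mul_eq_zero, ← plucker, hP0, zero_mul]
      have h03 : a 0 * b 3 - a 3 * b 0 ≠ 0 := by
        intro h03
        -- If p₀₃ vanished, the column (a₀, b₀) would be proportional to the two independent columns
        -- 1 and 2, hence zero, and X 1 would divide both cubics.
        have h12 : a 1 * b 2 - a 2 * b 1 ≠ 0 := by
          intro h12; rw [hQ, h03, h12] at hQ0; simp at hQ0
        exact e0 (indep _ _ _ _ _ _ h12 p01 hP0)
      have h12 := hor.resolve_left h03
      have h1 := indep (a 0) (b 0) (a 3) (b 3) (a 1) (b 1) h03 (by linear_combination -p01) hR0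
      have h2 := indep (a 0) (b 0) (a 3) (b 3) (a 2) (b 2) h03 (by linear_combination -hP0) p23
      exact ⟨h03, h1.1, h2.1, h1.2, h2.2⟩
    · exfalso
      have hQ0 : Q = 0 := by
        by_contra hQ0
        refine hroot (-(2 * R) / Q) (div_ne_zero (neg_ne_zero.2 (mul_ne_zero h2 hR0)) hQ0) ?_
        rw [hP0]; field_simp; ring
      -- Now p₀₃p₁₂ = 0 and 3p₀₃ + p₁₂ = 0, so p₀₃ = 0 because the characteristic is not 3.
      have h03 : a 0 * b 3 - a 3 * b 0 = 0 := by
        rw [hP0, zero_mul] at plucker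
        rcases mul_eq_zero.1 plucker.symm with h | h
        · exact h
        · rw [hQ, h, add_zero] at hQ0
          exact (mul_eq_zero.1 hQ0).resolve_left h3
      exact e0 (indep _ _ _ _ _ _ hR0 p01 h03)
  · exfalso
    have hR0 : R = 0 := by
      by_contra hR0
      -- A square root of the discriminant gives a root of the quadratic, nonzero since the constant
      -- term 2R is.
      obtain ⟨s, hs⟩ := IsAlgClosed.exists_pow_nat_eq (Q ^ 2 - 4 * (2 * P) * (2 * R)) (n := 2)
        (by norm_num)
      have hrt : 2 * P * ((-Q + s) / (2 * (2 * P))) ^ 2 + Q * ((-Q + s) / (2 * (2 * P))) + 2 * R = 0 := by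
        field_simp
        linear_combination hs
      by_cases ht : (-Q + s) / (2 * (2 * P)) = 0
      · rw [ht] at hrt
        simp [h2, hR0] at hrt
      · exact hroot _ ht hrt
    have hQ0 : Q = 0 := by
      by_contra hQ0
      refine hroot (-Q / (2 * P)) (div_ne_zero (neg_ne_zero.2 hQ0) (mul_ne_zero h2 hP0)) ?_
      rw [hR0]; field_simp; ring
    have h03 : a 0 * b 3 - a 3 * b 0 = 0 := by
      rw [hR0, mul_zero] at plucker
      rcases mul_eq_zero.1 plucker.symm with h | h
      · exact h
      · rw [hQ, h, add_zero] at hQ0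
        exact (mul_eq_zero.1 hQ0).resolve_left h3
    exact e3 (indep _ _ _ _ _ _ hP0 (by linear_combination -h03) (by linear_combination -p23))

theorem twoCubes_of_ramificationPoints [IsAlgClosed k] (h2 : (2 : k) ≠ 0) (h3 : (3 : k) ≠ 0)
    {f : Fin 2 → MvPolynomial (Fin 2) k} (hf : ∀ i, (f i).IsHomogeneous 3)
    (hrel : IsRelPrime (f 0) (f 1)) (hram : (ramificationPoints f).encard = 2) :
    TwoCubes (f 0) (f 1) := by
  obtain ⟨P, Q, hPQ, hset⟩ := Set.encard_eq_two.1 hram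
  obtain ⟨p, hp, rfl⟩ : ∃ p, ∃ hp : p ≠ 0, Projectivization.mk k p hp = P :=
    ⟨P.rep, P.rep_nonzero, P.mk_rep⟩
  obtain ⟨q, hq, rfl⟩ : ∃ q, ∃ hq : q ≠ 0, Projectivization.mk k q hq = Q :=
    ⟨Q.rep, Q.rep_nonzero, Q.mk_rep⟩
  have hwedge : ∀ v w : Fin 2 → k, ∀ (hv : v ≠ 0) (hw : w ≠ 0), v 0 * w 1 - w 0 * v 1 = 0 →
      Projectivization.mk k v hv = Projectivization.mk k w hw := by
    intro v w hv hw h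
    rw [Projectivization.mk_eq_mk_iff']
    by_cases hw0 : w 0 = 0
    · have hw1 : w 1 ≠ 0 := fun hw1 => hw (by ext i; fin_cases i <;> simp [hw0, hw1])
      refine ⟨v 1 / w 1, ?_⟩
      have hv0 : v 0 = 0 := by
        rw [hw0, zero_mul, sub_zero] at h
        exact (mul_eq_zero.1 h).resolve_right hw1
      ext i; fin_cases i
      · simp [hw0, hv0]
      · simp [hw1]
    · refine ⟨v 0 / w 0, ?_⟩
      ext i; fin_cases i
      · simp [hw0]
      · simp; field_simp; linear_combination h
  -- N moves the two ramification points to [1:0] and [0:1].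
  set N : Matrix (Fin 2) (Fin 2) k := !![p 0, q 0; p 1, q 1] with hNdef
  have hN : N.det ≠ 0 := by
    intro h
    refine hPQ (hwedge p q hp hq ?_)
    simpa [hNdef, Matrix.det_fin_two] using h
  have hmul : ∀ s t, N.mulVec ![s, t] = s • p + t • q := by
    intro s t
    ext i
    fin_cases i <;> simp [hNdef, Matrix.mulVec, dotProduct, Fin.sum_univ_two] <;> ring
  have hfN : ∀ i, (subst₂ N (f i)).IsHomogeneous 3 := by
    intro i
    have := (hf i).aeval (fun i => C (N i 0) * X 0 + C (N i 1) * X 1 : Fin 2 → MvPolynomial (Fin 2) k)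
      (n := 1) (fun i => by
        refine IsHomogeneous.add ?_ ?_ <;>
        simpa using (isHomogeneous_C _ _).mul (isHomogeneous_X k _))
    exact this
  obtain ⟨a, ha⟩ := exists_eq_binaryCubic (hfN 0)
  obtain ⟨b, hb⟩ := exists_eq_binaryCubic (hfN 1)
  have hfab : (fun i => subst₂ N (f i)) = ![binaryCubic a, binaryCubic b] := by
    funext i
    fin_cases i
    · exact ha
    · exact hb
  have hiff : ∀ v, IsRamified ![binaryCubic a, binaryCubic b] v ↔ IsRamified f (N.mulVec v) := by
    intro v
    rw [← hfab, isRamified_subst₂_iff hN]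
  have hrel' := isRelPrime_subst₂ hN hrel
  rw [ha, hb] at hrel'
  obtain ⟨h03, ha1, ha2, hb1, hb2⟩ := binaryCubic_wedge h2 h3 hrel'
    (by rw [hiff, hmul, one_smul, zero_smul, add_zero, ← mk_mem_ramificationPoints hf hp, hset]
        exact Or.inl rfl)
    (by rw [hiff, hmul, one_smul, zero_smul, zero_add, ← mk_mem_ramificationPoints hf hq, hset]
        exact Or.inr rfl)
    (by
      intro t ht
      rw [hiff, hmul, one_smul]
      intro hr
      have hdet : p 0 * q 1 - q 0 * p 1 ≠ 0 := by
        simpa [hNdef, Matrix.det_fin_two] using hN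
      have hmem : ∀ hv : t • p + q ≠ 0, Projectivization.mk k _ hv ∈ ramificationPoints f :=
        fun hv => (mk_mem_ramificationPoints hf hv).2 hr
      have hv : t • p + q ≠ 0 := by
        intro hv
        have hv0 := congrFun hv 0
        have hv1 := congrFun hv 1
        simp at hv0 hv1
        exact hdet (by linear_combination p 0 * hv1 - p 1 * hv0)
      have hm := hmem hv
      rw [hset] at hm
      rcases hm with hm | hm
      · rw [Projectivization.mk_eq_mk_iff'] at hm
        obtain ⟨c, hc⟩ := hm
        have hv0 := congrFun hc 0
        have hv1 := congrFun hc 1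
        simp at hv0 hv1
        exact hdet (by linear_combination p 1 * hv0 - p 0 * hv1)
      · rw [Set.mem_singleton_iff, Projectivization.mk_eq_mk_iff'] at hm
        obtain ⟨c, hc⟩ := hm
        have hv0 := congrFun hc 0
        have hv1 := congrFun hc 1
        simp at hv0 hv1
        exact mul_ne_zero ht hdet (by linear_combination q 0 * hv1 - q 1 * hv0))
  have h0 : f 0 = subst₂ N⁻¹ (binaryCubic a) := by rw [← ha, subst₂_inv_subst₂ hN]
  have h1 : f 1 = subst₂ N⁻¹ (binaryCubic b) := by rw [← hb, subst₂_inv_subst₂ hN]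
  rw [h0, h1]
  refine TwoCubes.subst₂ ?_ (N := N⁻¹) (by
    rw [Matrix.det_nonsing_inv, Ring.inverse_eq_inv']; exact inv_ne_zero hN)
  have hinv : (C (a 0 * b 3 - a 3 * b 0)⁻¹ : MvPolynomial (Fin 2) k) *
      (C (a 0) * C (b 3) - C (a 3) * C (b 0)) = 1 := by
    rw [← C_mul, ← C_mul, ← C_sub, ← C_mul, inv_mul_cancel₀ h03, C_1]
  refine ⟨![1, 0], ![0, 1], by simp, ⟨b 3 / (a 0 * b 3 - a 3 * b 0), -a 3 / (a 0 * b 3 - a 3 * b 0), ?_⟩,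
    ⟨-b 0 / (a 0 * b 3 - a 3 * b 0), a 0 / (a 0 * b 3 - a 3 * b 0), ?_⟩⟩
  · simp only [binaryCubic, ha1, ha2, hb1, hb2, div_eq_mul_inv, C_mul, C_neg, C_0]
    simp
    linear_combination X 0 ^ 3 * hinv
  · simp only [binaryCubic, ha1, ha2, hb1, hb2, div_eq_mul_inv, C_mul, C_neg, C_0]
    simp
    linear_combination X 1 ^ 3 * hinv

/-! ### The hypotheses on a line, read in an arbitrary adapted frame. -/

theorem containsLine_changeCoords [Infinite k] {F : MvPolynomial (Fin 4) k}
    {l : Submodule k (Fin 4 → k)} (hl : ∀ v ∈ l, eval v F = 0) {A : GL (Fin 4) k}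
    (hA : IsAdapted A l) : ContainsLine (changeCoords A F) := by
  refine MvPolynomial.funext fun v => ?_
  have h : eval v (bind₁ ![0, 0, X 0, X 1] (changeCoords A F)) =
      eval ![0, 0, v 0, v 1] (changeCoords A F) := by
    rw [← aeval_eq_eval, ← aeval_eq_eval, aeval_bind₁]
    congr 2
    funext i
    fin_cases i <;> simp
  rw [h, eval_changeCoords, map_zero]
  exact hl _ ((hA _).2 ⟨rfl, rfl⟩)

theorem isHomogeneous_bind₁_pderiv {G : MvPolynomial (Fin 4) k} (hG : G.IsHomogeneous 4)
    (i : Fin 4) :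
    (bind₁ ![0, 0, X 0, X 1] (pderiv i G) : MvPolynomial (Fin 2) k).IsHomogeneous 3 := by
  refine (hG.pderiv (i := i)).aeval (![0, 0, X 0, X 1] : Fin 4 → MvPolynomial (Fin 2) k) (n := 1)
    fun i => ?_
  fin_cases i
  · exact isHomogeneous_zero _ _ _
  · exact isHomogeneous_zero _ _ _
  · exact isHomogeneous_X _ _
  · exact isHomogeneous_X _ _

theorem isHomogeneous_alpha {G : MvPolynomial (Fin 4) k} (hG : G.IsHomogeneous 4)
    (hl : ContainsLine G) : (alpha G).IsHomogeneous 3 :=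
  alpha_eq hl ▸ isHomogeneous_bind₁_pderiv hG 0

theorem isHomogeneous_beta {G : MvPolynomial (Fin 4) k} (hG : G.IsHomogeneous 4)
    (hl : ContainsLine G) : (beta G).IsHomogeneous 3 :=
  beta_eq hl ▸ isHomogeneous_bind₁_pderiv hG 1

theorem eq_C_of_isHomogeneous_mul {σ : Type*} {h f : MvPolynomial σ k} {n : ℕ} (hh : h ≠ 0)
    (hf0 : f ≠ 0) (hf : f.IsHomogeneous n) (hhf : (h * f).IsHomogeneous n) : ∃ c, h = C c := by
  have h1 := totalDegree_mul_of_isDomain hh hf0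
  rw [hf.totalDegree hf0, hhf.totalDegree (mul_ne_zero hh hf0)] at h1
  exact ⟨_, totalDegree_eq_zero_iff_eq_C.1 (by omega)⟩

/-- α and β already have degree 3, so a morphism of degree 3 leaves only a constant common factor.
-/
theorem isRelPrime_alpha_beta {G : MvPolynomial (Fin 4) k} (hG : G.IsHomogeneous 4)
    (hl : ContainsLine G) {f : Fin 2 → MvPolynomial (Fin 2) k} (hf : IsInducedMorphism G f)
    (hdeg : ∀ i, (f i).IsHomogeneous 3) : IsRelPrime (alpha G) (beta G) := by
  obtain ⟨hrel, h, h0, hb, ha⟩ := hf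
  have hc : ∃ c, h = C c := by
    by_cases hf0 : f 0 = 0
    · have hf1 : f 1 ≠ 0 := by
        intro hf1
        rw [hf0, hf1] at hrel
        exact not_isUnit_zero (hrel dvd_rfl dvd_rfl)
      exact eq_C_of_isHomogeneous_mul h0 hf1 (hdeg 1) (ha ▸ (isHomogeneous_alpha hG hl).neg)
    · exact eq_C_of_isHomogeneous_mul h0 hf0 (hdeg 0) (hb ▸ isHomogeneous_beta hG hl)
  obtain ⟨c, rfl⟩ := hc
  have hu : IsUnit (C c : MvPolynomial (Fin 2) k) := by
    refine IsUnit.map C (IsUnit.mk0 _ ?_)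
    rintro rfl
    exact h0 C_0
  intro d h1 h2
  refine hrel ?_ ?_
  · rwa [← hu.dvd_mul_left, ← hb]
  · rwa [← hu.dvd_mul_left, ← ha, dvd_neg]

/-- What the degree, the ramification and the kind of a line say in adapted coordinates. -/
theorem adapted_of_secondKind [IsAlgClosed k] (h2 : (2 : k) ≠ 0) (h3 : (3 : k) ≠ 0)
    {F : MvPolynomial (Fin 4) k} (hF : F.IsHomogeneous 4) {l : Submodule k (Fin 4 → k)}
    (hl : IsLineOn F l) (hdeg : HasDegree F l 3) (hram : HasRamificationCount F l 2)
    (hkind : IsSecondKind F l) {A : GL (Fin 4) k} (hA : IsAdapted A l) :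
    ContainsLine (changeCoords A F) ∧
    TwoCubes (alpha (changeCoords A F)) (beta (changeCoords A F)) ∧
    HessianVanishes (changeCoords A F) := by
  have : Infinite k := IsAlgClosed.instInfinite
  have hcont : ∀ {B : GL (Fin 4) k}, IsAdapted B l → ContainsLine (changeCoords B F) :=
    fun hB => containsLine_changeCoords hl.2 hB
  refine ⟨hcont hA, ?_, ?_⟩
  · obtain ⟨D, fD, hD, hfD, hdegD⟩ := hdeg
    obtain ⟨B, f, hB, ⟨hrel, h, h0, hb, ha⟩, hcount⟩ := hram
    have hrelD := isRelPrime_alpha_beta (changeCoords_isHomogeneous D hF) (hcont hD) hfD hdegD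
    obtain ⟨T, hT, rfl⟩ := hD.exists_mul hB
    have hrelB := isRelPrime_alpha_beta_changeCoords hT (hcont hD) hrelD
    rw [changeCoords_changeCoords] at hrelB
    have hGB := changeCoords_isHomogeneous (D * T) hF
    -- The pair witnessing the ramification carries its own common factor; coprimality, transported
    -- from the frame of the degree, makes that factor a unit and the pair cubic.
    have hu : IsUnit h := hrelB (by rw [← dvd_neg, ha]; exact dvd_mul_right _ _)
      (by rw [hb]; exact dvd_mul_right _ _)
    obtain ⟨c, hc, rfl⟩ := isUnit_iff_eq_C_of_isReduced.1 hu
    have hcc : (C c⁻¹ : MvPolynomial (Fin 2) k) * C c = 1 := by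
      rw [← C_mul, inv_mul_cancel₀ hc.ne_zero, C_1]
    have hf0 : f 0 = C c⁻¹ * beta (changeCoords (D * T) F) := by
      rw [hb, ← mul_assoc, hcc, one_mul]
    have hf1 : f 1 = C c⁻¹ * -alpha (changeCoords (D * T) F) := by
      rw [ha, ← mul_assoc, hcc, one_mul]
    have hf : ∀ i, (f i).IsHomogeneous 3 := by
      intro i
      fin_cases i
      · simpa [hf0] using (isHomogeneous_C _ c⁻¹).mul (isHomogeneous_beta hGB (hcont hB))
      · simpa [hf1] using (isHomogeneous_C _ c⁻¹).mul (isHomogeneous_alpha hGB (hcont hB)).neg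
    have htwo := twoCubes_of_ramificationPoints h2 h3 hf hrel hcount
    -- This matrix turns (f 0, f 1) = c⁻¹(β, -α) back into (α, β).
    have htwo' := htwo.combination (M := !![0, c; -c, 0])
      (by simp [Matrix.det_fin_two, hc.ne_zero])
    simp [← hb, ← ha] at htwo'
    obtain ⟨S, hS, rfl⟩ := hB.exists_mul hA
    rw [← changeCoords_changeCoords]
    exact htwo'.changeCoords hS (hcont hB)
  · obtain ⟨-, B, hB, hH⟩ := hkind
    obtain ⟨S, hS, rfl⟩ := hB.exists_mul hA
    rw [← changeCoords_changeCoords]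
    exact hH.changeCoords hS (hcont hB)

/-! ### Normal form of a quartic along one line. -/

theorem coeff_eq_zero_of_sum_eq_zero [Infinite k] {n : ℕ} (c : Fin n → k)
    (h : ∀ x : k, ∑ i, c i * x ^ (i : ℕ) = 0) (i : Fin n) : c i = 0 := by
  have hp : (∑ i, Polynomial.C (c i) * Polynomial.X ^ (i : ℕ)) = (0 : Polynomial k) := by
    refine Polynomial.funext fun x => ?_
    simpa [Polynomial.eval_finsetSum] using h x
  have := congrArg (fun p => Polynomial.coeff p i) hp
  simpa [Polynomial.finsetSum_coeff, Polynomial.coeff_X_pow, Fin.val_inj] using this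

theorem IsAdapted.mul {A T : GL (Fin 4) k} {l : Submodule k (Fin 4 → k)} (hA : IsAdapted A l)
    (hT : PreservesLine T) : IsAdapted (A * T) l := by
  intro v
  rw [Units.val_mul, ← Matrix.mulVec_mulVec, hA]
  have hdet := hT.det_pencilBlock_ne_zero
  obtain ⟨h1, h2, h3, h4⟩ := hT
  simp only [Matrix.mulVec, dotProduct, Fin.sum_univ_four, h1, h2, h3, h4, zero_mul, add_zero]
  simp only [pencilBlock, Matrix.det_fin_two_of] at hdet
  constructor
  · rintro ⟨e1, e2⟩
    constructor
    · refine (mul_eq_zero.1 (?_ : _ * v 0 = 0)).resolve_left hdet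
      linear_combination T.1 1 1 * e1 - T.1 0 1 * e2
    · refine (mul_eq_zero.1 (?_ : _ * v 1 = 0)).resolve_left hdet
      linear_combination T.1 0 0 * e2 - T.1 1 0 * e1
  · rintro ⟨e1, e2⟩
    simp [e1, e2]

theorem exists_adapted_cubes {F : MvPolynomial (Fin 4) k} {l : Submodule k (Fin 4 → k)}
    {A : GL (Fin 4) k} (hA : IsAdapted A l) (hl : ContainsLine (changeCoords A F))
    (h : TwoCubes (alpha (changeCoords A F)) (beta (changeCoords A F))) :
    ∃ B, IsAdapted B l ∧ alpha (changeCoords B F) = X 1 ^ 3 ∧ beta (changeCoords B F) = X 0 ^ 3 := by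
  obtain ⟨p, q, hpq, ⟨a, b, hp⟩, ⟨a', b', hq⟩⟩ := h
  set D := p 0 * q 1 - p 1 * q 0 with hD
  -- The substitution on the line that makes the linear forms p and q the coordinates x₃ and x₂.
  set N : Matrix (Fin 2) (Fin 2) k := !![-p 1 / D, q 1 / D; p 0 / D, -q 0 / D] with hN
  have hNp : subst₂ N (C (p 0) * X 0 + C (p 1) * X 1) = X 1 := by
    have h1 : p 0 * (-p 1 / D) + p 1 * (p 0 / D) = 0 := by ring
    have h2 : p 0 * (q 1 / D) + p 1 * (-q 0 / D) = 1 := by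
      field_simp; rw [hD]; ring
    have h1' := congrArg (C : k → MvPolynomial (Fin 2) k) h1
    have h2' := congrArg (C : k → MvPolynomial (Fin 2) k) h2
    simp only [C_add, C_mul, C_0, C_1] at h1' h2'
    simp only [subst₂, hN, map_add, map_mul, bind₁_C_right, bind₁_X_right]
    simp
    linear_combination X 0 * h1' + X 1 * h2'
  have hNq : subst₂ N (C (q 0) * X 0 + C (q 1) * X 1) = X 0 := by
    have h1 : q 0 * (-p 1 / D) + q 1 * (p 0 / D) = 1 := by
      field_simp; rw [hD]; ring
    have h2 : q 0 * (q 1 / D) + q 1 * (-q 0 / D) = 0 := by ring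
    have h1' := congrArg (C : k → MvPolynomial (Fin 2) k) h1
    have h2' := congrArg (C : k → MvPolynomial (Fin 2) k) h2
    simp only [C_add, C_mul, C_0, C_1] at h1' h2'
    simp only [subst₂, hN, map_add, map_mul, bind₁_C_right, bind₁_X_right]
    simp
    linear_combination X 0 * h1' + X 1 * h2'
  -- Proportional coefficient pairs would give a linear relation between the cubes of independent
  -- linear forms.
  have hab : a * b' - a' * b ≠ 0 := by
    intro hab
    have hab' : (C a * C b' - C a' * C b : MvPolynomial (Fin 2) k) = 0 := by
      rw [← C_mul, ← C_mul, ← C_sub, hab, C_0]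
    have e1 := congrArg (subst₂ N) (show C b' * (C (p 0) * X 0 + C (p 1) * X 1) ^ 3 -
        C b * (C (q 0) * X 0 + C (q 1) * X 1) ^ 3 = 0 by
      rw [← hp, ← hq]; linear_combination alpha (changeCoords A F) * hab')
    have e2 := congrArg (subst₂ N) (show C a' * (C (p 0) * X 0 + C (p 1) * X 1) ^ 3 -
        C a * (C (q 0) * X 0 + C (q 1) * X 1) ^ 3 = 0 by
      rw [← hp, ← hq]; linear_combination -beta (changeCoords A F) * hab')
    rw [map_sub, map_mul, map_mul, map_pow, map_pow, hNp, hNq, subst₂_C, subst₂_C, map_zero]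
      at e1 e2
    have e3 := congrArg (eval ![1, 0]) e1
    have e4 := congrArg (eval ![1, 0]) e2
    simp at e3 e4
    rw [e3, e4] at hp
    have e5 := congrArg (subst₂ N) hp
    rw [map_pow, hNp] at e5
    have e6 := congrArg (eval ![0, 1]) e5
    simp at e6
  have hdet : (!![a, a', 0, 0; b, b', 0, 0; 0, 0, N 0 0, N 0 1; 0, 0, N 1 0, N 1 1] :
      Matrix (Fin 4) (Fin 4) k).det ≠ 0 := by
    have : (!![a, a', 0, 0; b, b', 0, 0; 0, 0, N 0 0, N 0 1; 0, 0, N 1 0, N 1 1] :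
      Matrix (Fin 4) (Fin 4) k).det = (a * b' - a' * b) * (-D⁻¹) := by
      rw [Matrix.det_succ_row_zero]
      simp [Fin.sum_univ_four, Matrix.det_fin_three, Fin.succAbove, hN]
      field_simp
      rw [hD]
      ring
    rw [this]
    exact mul_ne_zero hab (neg_ne_zero.2 (inv_ne_zero hpq))
  set T := Matrix.GeneralLinearGroup.mkOfDetNeZero _ hdet with hTdef
  have hT : PreservesLine T := ⟨rfl, rfl, rfl, rfl⟩
  have hTN : lineBlock T = N := by
    ext i j
    fin_cases i <;> fin_cases j <;> rfl
  refine ⟨A * T, hA.mul hT, ?_, ?_⟩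
  · rw [← changeCoords_changeCoords, alpha_changeCoords hT hl, hTN]
    have : T.1 0 0 = a ∧ T.1 1 0 = b := ⟨rfl, rfl⟩
    rw [this.1, this.2, ← subst₂_C N a, ← subst₂_C N b, ← map_mul, ← map_mul, ← map_add, hp,
      map_pow, hNp]
  · rw [← changeCoords_changeCoords, beta_changeCoords hT hl, hTN]
    have : T.1 0 1 = a' ∧ T.1 1 1 = b' := ⟨rfl, rfl⟩
    rw [this.1, this.2, ← subst₂_C N a', ← subst₂_C N b', ← map_mul, ← map_mul, ← map_add, hq,
      map_pow, hNq]

/-- The quartic `x₀ x₃³ + x₁ x₂³ + a x₂² + b x₂ x₃ + c x₃² + d x₂ + e x₃ + g`, where `a, b, …, g`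
are forms in `x₀, x₁`, given by their coefficients. -/
def cubesQuartic (a b c : Fin 3 → k) (d e : Fin 4 → k) (g : Fin 5 → k) :
    MvPolynomial (Fin 4) k :=
  X 0 * X 3 ^ 3 + X 1 * X 2 ^ 3 +
  (C (a 0) * X 0 ^ 2 + C (a 1) * (X 0 * X 1) + C (a 2) * X 1 ^ 2) * X 2 ^ 2 +
  (C (b 0) * X 0 ^ 2 + C (b 1) * (X 0 * X 1) + C (b 2) * X 1 ^ 2) * (X 2 * X 3) +
  (C (c 0) * X 0 ^ 2 + C (c 1) * (X 0 * X 1) + C (c 2) * X 1 ^ 2) * X 3 ^ 2 +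
  (C (d 0) * X 0 ^ 3 + C (d 1) * (X 0 ^ 2 * X 1) + C (d 2) * (X 0 * X 1 ^ 2) + C (d 3) * X 1 ^ 3) *
    X 2 +
  (C (e 0) * X 0 ^ 3 + C (e 1) * (X 0 ^ 2 * X 1) + C (e 2) * (X 0 * X 1 ^ 2) + C (e 3) * X 1 ^ 3) *
    X 3 +
  (C (g 0) * X 0 ^ 4 + C (g 1) * (X 0 ^ 3 * X 1) + C (g 2) * (X 0 ^ 2 * X 1 ^ 2) +
    C (g 3) * (X 0 * X 1 ^ 3) + C (g 4) * X 1 ^ 4)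

theorem antidiagonalTuple_four_four : List.Nat.antidiagonalTuple 4 4 =
    [![0, 0, 0, 4], ![0, 0, 1, 3], ![0, 0, 2, 2], ![0, 0, 3, 1], ![0, 0, 4, 0],
    ![0, 1, 0, 3], ![0, 1, 1, 2], ![0, 1, 2, 1], ![0, 1, 3, 0], ![0, 2, 0, 2],
    ![0, 2, 1, 1], ![0, 2, 2, 0], ![0, 3, 0, 1], ![0, 3, 1, 0], ![0, 4, 0, 0],
    ![1, 0, 0, 3], ![1, 0, 1, 2], ![1, 0, 2, 1], ![1, 0, 3, 0], ![1, 1, 0, 2],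
    ![1, 1, 1, 1], ![1, 1, 2, 0], ![1, 2, 0, 1], ![1, 2, 1, 0], ![1, 3, 0, 0],
    ![2, 0, 0, 2], ![2, 0, 1, 1], ![2, 0, 2, 0], ![2, 1, 0, 1], ![2, 1, 1, 0],
    ![2, 2, 0, 0], ![3, 0, 0, 1], ![3, 0, 1, 0], ![3, 1, 0, 0], ![4, 0, 0, 0]] := by
  decide

/-- Of the 35 quartic monomials, those free of x₀, x₁ drop out because the line lies on the surface,
and those linear in x₀, x₁ are dictated by α and β. -/
theorem exists_eq_cubesQuartic [Infinite k] {G : MvPolynomial (Fin 4) k} (hG : G.IsHomogeneous 4)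
    (hl : ContainsLine G) (hα : alpha G = X 1 ^ 3) (hβ : beta G = X 0 ^ 3) :
    ∃ a b c d e g, G = cubesQuartic a b c d e g := by
  obtain ⟨c, hc⟩ := isHomogeneous_eq_sum hG
  change _ = (List.map (fun s => C (c s) * ∏ i, X i ^ s i) (List.Nat.antidiagonalTuple 4 4)).sum at hc
  rw [antidiagonalTuple_four_four] at hc
  simp only [List.map_cons, List.map_nil, List.sum_cons, List.sum_nil, Fin.prod_univ_four,
    Matrix.cons_val, pow_zero, pow_one, mul_one, one_mul, add_zero] at hc
  rw [alpha_eq hl] at hα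
  rw [beta_eq hl] at hβ
  have z0 := coeff_eq_zero_of_sum_eq_zero ![c ![0, 0, 0, 4], c ![0, 0, 1, 3], c ![0, 0, 2, 2], c ![0, 0, 3, 1], c ![0, 0, 4, 0]] (fun x => by
    have := congrArg (eval ![x, 1]) hl
    rw [hc] at this
    simp [Fin.sum_univ_succ] at this ⊢
    linear_combination this)
  have z1 := coeff_eq_zero_of_sum_eq_zero ![c ![1, 0, 0, 3] - 1, c ![1, 0, 1, 2], c ![1, 0, 2, 1], c ![1, 0, 3, 0]] (fun x => by
    have := congrArg (eval ![x, 1]) hα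
    rw [hc] at this
    simp [Fin.sum_univ_succ, pderiv_X, Derivation.leibniz, Derivation.leibniz_pow] at this ⊢
    linear_combination this)
  have z2 := coeff_eq_zero_of_sum_eq_zero ![c ![0, 1, 0, 3], c ![0, 1, 1, 2], c ![0, 1, 2, 1], c ![0, 1, 3, 0] - 1] (fun x => by
    have := congrArg (eval ![x, 1]) hβ
    rw [hc] at this
    simp [Fin.sum_univ_succ, pderiv_X, Derivation.leibniz, Derivation.leibniz_pow] at this ⊢
    linear_combination this)
  simp [Fin.forall_fin_succ, sub_eq_zero] at z0 z1 z2
  refine ⟨![c ![2, 0, 2, 0], c ![1, 1, 2, 0], c ![0, 2, 2, 0]],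
    ![c ![2, 0, 1, 1], c ![1, 1, 1, 1], c ![0, 2, 1, 1]],
    ![c ![2, 0, 0, 2], c ![1, 1, 0, 2], c ![0, 2, 0, 2]],
    ![c ![3, 0, 1, 0], c ![2, 1, 1, 0], c ![1, 2, 1, 0], c ![0, 3, 1, 0]],
    ![c ![3, 0, 0, 1], c ![2, 1, 0, 1], c ![1, 2, 0, 1], c ![0, 3, 0, 1]],
    ![c ![4, 0, 0, 0], c ![3, 1, 0, 0], c ![2, 2, 0, 0], c ![1, 3, 0, 0], c ![0, 4, 0, 0]], ?_⟩
  rw [hc, cubesQuartic]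
  simp [z0, z1, z2]
  ring

theorem residualCubic_cubesQuartic (a b c : Fin 3 → k) (d e : Fin 4 → k) (g : Fin 5 → k) :
    residualCubic (cubesQuartic a b c d e g) =
      X 0 * X 4 ^ 3 + X 1 * X 3 ^ 3 +
      (C (a 0) * X 0 ^ 2 + C (a 1) * (X 0 * X 1) + C (a 2) * X 1 ^ 2) * (X 2 * X 3 ^ 2) +
      (C (b 0) * X 0 ^ 2 + C (b 1) * (X 0 * X 1) + C (b 2) * X 1 ^ 2) * (X 2 * (X 3 * X 4)) +
      (C (c 0) * X 0 ^ 2 + C (c 1) * (X 0 * X 1) + C (c 2) * X 1 ^ 2) * (X 2 * X 4 ^ 2) +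
      (C (d 0) * X 0 ^ 3 + C (d 1) * (X 0 ^ 2 * X 1) + C (d 2) * (X 0 * X 1 ^ 2) +
        C (d 3) * X 1 ^ 3) * (X 2 ^ 2 * X 3) +
      (C (e 0) * X 0 ^ 3 + C (e 1) * (X 0 ^ 2 * X 1) + C (e 2) * (X 0 * X 1 ^ 2) +
        C (e 3) * X 1 ^ 3) * (X 2 ^ 2 * X 4) +
      (C (g 0) * X 0 ^ 4 + C (g 1) * (X 0 ^ 3 * X 1) + C (g 2) * (X 0 ^ 2 * X 1 ^ 2) +
        C (g 3) * (X 0 * X 1 ^ 3) + C (g 4) * X 1 ^ 4) * X 2 ^ 3 := by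
  apply residualCubic_eq
  simp [cubesQuartic]
  ring

theorem alpha_cubesQuartic (a b c : Fin 3 → k) (d e : Fin 4 → k) (g : Fin 5 → k) :
    alpha (cubesQuartic a b c d e g) = X 1 ^ 3 := by
  rw [alpha, residualCubic_cubesQuartic]
  simp

theorem beta_cubesQuartic (a b c : Fin 3 → k) (d e : Fin 4 → k) (g : Fin 5 → k) :
    beta (cubesQuartic a b c d e g) = X 0 ^ 3 := by
  rw [beta, residualCubic_cubesQuartic]
  simp

set_option maxRecDepth 4000 in
theorem eval_hessian_cubesQuartic (a b c : Fin 3 → k) (d e : Fin 4 → k) (g : Fin 5 → k)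
    (s t x y : k) :
    eval ![s, t, 0, x, y] (hessian (cubesQuartic a b c d e g)) =
      72 * s * t * x * y * ((d 0 * s ^ 3 + d 1 * (s ^ 2 * t) + d 2 * (s * t ^ 2) + d 3 * t ^ 3) * x +
        (e 0 * s ^ 3 + e 1 * (s ^ 2 * t) + e 2 * (s * t ^ 2) + e 3 * t ^ 3) * y) -
      6 * s * y * (2 * (a 0 * s ^ 2 + a 1 * (s * t) + a 2 * t ^ 2) * x +
        (b 0 * s ^ 2 + b 1 * (s * t) + b 2 * t ^ 2) * y) ^ 2 -
      6 * t * x * ((b 0 * s ^ 2 + b 1 * (s * t) + b 2 * t ^ 2) * x +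
        2 * (c 0 * s ^ 2 + c 1 * (s * t) + c 2 * t ^ 2) * y) ^ 2 := by
  have e0 : (Fin.natAdd 2 (0 : Fin 3) : Fin 5) = 2 := rfl
  have e1 : (Fin.natAdd 2 (1 : Fin 3) : Fin 5) = 3 := rfl
  have e2 : (Fin.natAdd 2 (2 : Fin 3) : Fin 5) = 4 := rfl
  rw [hessian, residualCubic_cubesQuartic, Matrix.det_fin_three]
  simp only [Matrix.of_apply, e0, e1, e2]
  have h2 : ∀ i, pderiv i (2 : MvPolynomial (Fin 5) k) = 0 := fun i => pderiv_C (a := 2)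
  have h3 : ∀ i, pderiv i (3 : MvPolynomial (Fin 5) k) = 0 := fun i => pderiv_C (a := 3)
  simp [pderiv_X, Derivation.leibniz, Derivation.leibniz_pow, h2, h3]
  ring

/-- Eliminating the parameter means s = x³, t = -1 at the point [x : 1]. The terms in b² cancel
because s + t x³ = 0 there, so b itself is not forced to vanish. -/
theorem hessianVanishes_cubesQuartic [Infinite k] (h2 : (2 : k) ≠ 0) (h3 : (3 : k) ≠ 0)
    {a b c : Fin 3 → k} {d e : Fin 4 → k} {g : Fin 5 → k}
    (h : HessianVanishes (cubesQuartic a b c d e g)) :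
    a 0 = 0 ∧ c 2 = 0 ∧
    3 * d 0 = b 0 * c 0 ∧ 3 * d 1 = a 1 ^ 2 + b 0 * c 1 + b 1 * c 0 ∧
    3 * d 2 = 2 * a 1 * a 2 + b 1 * c 1 + b 2 * c 0 ∧ 3 * d 3 = a 2 ^ 2 + b 2 * c 1 ∧
    3 * e 0 = c 0 ^ 2 + a 1 * b 0 ∧ 3 * e 1 = a 1 * b 1 + a 2 * b 0 + 2 * c 0 * c 1 ∧
    3 * e 2 = a 1 * b 2 + a 2 * b 1 + c 1 ^ 2 ∧ 3 * e 3 = a 2 * b 2 := by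
  have h24 : (-24 : k) ≠ 0 := by
    have : (-24 : k) = -(2 ^ 3 * 3) := by norm_num
    rw [this]
    exact neg_ne_zero.2 (mul_ne_zero (pow_ne_zero _ h2) h3)
  have hx : ∀ x : k, eval ![x ^ 3, -1, 0, x, 1] (hessian (cubesQuartic a b c d e g)) = 0 := by
    intro x
    have := congrArg (eval ![x, 1]) h
    rw [map_zero, alpha_cubesQuartic, beta_cubesQuartic, ← aeval_eq_eval, aeval_bind₁] at this
    rw [← aeval_eq_eval]
    refine Eq.trans ?_ this
    congr 2
    funext i
    fin_cases i <;> simp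
  -- The coefficients of the hessian divided by -24, by increasing powers of x. The squares at x and
  -- x¹⁷ give c₂ = a₀ = 0; the other entries used then determine d and e.
  have z := coeff_eq_zero_of_sum_eq_zero ![0, -c 2 ^ 2, -(b 2 * c 2),
    0, -(3 * e 3) + a 2 * b 2 + 2 * c 1 * c 2, -(3 * d 3) + a 2 ^ 2 + b 1 * c 2 + b 2 * c 1,
    0, 3 * e 2 - (a 1 * b 2 + a 2 * b 1) - (c 1 ^ 2 + 2 * c 0 * c 2),
      3 * d 2 - 2 * a 1 * a 2 - (b 0 * c 2 + b 1 * c 1 + b 2 * c 0),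
    0, -(3 * e 1) + (a 0 * b 2 + a 1 * b 1 + a 2 * b 0) + 2 * c 0 * c 1,
      -(3 * d 1) + a 1 ^ 2 + 2 * a 0 * a 2 + b 0 * c 1 + b 1 * c 0,
    0, 3 * e 0 - (a 0 * b 1 + a 1 * b 0) - c 0 ^ 2, 3 * d 0 - 2 * a 0 * a 1 - b 0 * c 0,
    0, a 0 * b 0, a 0 ^ 2] (fun x => by
      have := hx x
      rw [eval_hessian_cubesQuartic] at this
      simp [Fin.sum_univ_succ]
      refine (mul_eq_zero.1 (?_ : (-24 : k) * _ = 0)).resolve_left h24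
      linear_combination this)
  have hc : c 2 = 0 := by simpa using z 1
  have ha : a 0 = 0 := by simpa using z 17
  have z4 := z 4
  have z5 := z 5
  have z7 := z 7
  have z8 := z 8
  have z10 := z 10
  have z11 := z 11
  have z13 := z 13
  have z14 := z 14
  simp [hc, ha] at z4 z5 z7 z8 z10 z11 z13 z14
  refine ⟨ha, hc, ?_, ?_, ?_, ?_, ?_, ?_, ?_, ?_⟩
  · linear_combination z14
  · linear_combination -z11
  · linear_combination z8
  · linear_combination -z5
  · linear_combination z13
  · linear_combination -z10
  · linear_combination z7
  · linear_combination -z4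

/-- The quartics `x₀ x₃³ + x₁ x₂³ + b x₂ x₃ + g`, with `b, g` forms in `x₀, x₁`. -/
def secondKindQuartic (b : Fin 3 → k) (g : Fin 5 → k) : MvPolynomial (Fin 4) k :=
  X 0 * X 3 ^ 3 + X 1 * X 2 ^ 3 +
  (C (b 0) * X 0 ^ 2 + C (b 1) * (X 0 * X 1) + C (b 2) * X 1 ^ 2) * (X 2 * X 3) +
  (C (g 0) * X 0 ^ 4 + C (g 1) * (X 0 ^ 3 * X 1) + C (g 2) * (X 0 ^ 2 * X 1 ^ 2) +
    C (g 3) * (X 0 * X 1 ^ 3) + C (g 4) * X 1 ^ 4)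

theorem exists_secondKindQuartic [IsAlgClosed k] (h2 : (2 : k) ≠ 0) (h3 : (3 : k) ≠ 0)
    {F : MvPolynomial (Fin 4) k} (hF : F.IsHomogeneous 4) {l : Submodule k (Fin 4 → k)}
    (hl : IsLineOn F l) (hdeg : HasDegree F l 3) (hram : HasRamificationCount F l 2)
    (hkind : IsSecondKind F l) :
    ∃ A b g, IsAdapted A l ∧ changeCoords A F = secondKindQuartic b g := by
  have : Infinite k := IsAlgClosed.instInfinite
  obtain ⟨A₀, -, hA₀, -⟩ := id hdeg
  obtain ⟨hl₀, htwo, -⟩ := adapted_of_secondKind h2 h3 hF hl hdeg hram hkind hA₀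
  obtain ⟨A, hA, hα, hβ⟩ := exists_adapted_cubes hA₀ hl₀ htwo
  obtain ⟨hl₁, -, hH⟩ := adapted_of_secondKind h2 h3 hF hl hdeg hram hkind hA
  obtain ⟨a, b, c, d, e, g, hG⟩ :=
    exists_eq_cubesQuartic (changeCoords_isHomogeneous A hF) hl₁ hα hβ
  rw [hG] at hH
  obtain ⟨ha0, hc2, hd0, hd1, hd2, hd3, he0, he1, he2, he3⟩ := hessianVanishes_cubesQuartic h2 h3 hH
  -- Now a = 3x₁(p x₀ + q x₁) and c = 3x₀(r x₀ + s x₁). The cubes are completed by x₂ ↦ x₂ - p x₀ -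
  -- q x₁ and x₃ ↦ x₃ - r x₀ - s x₁, and the hessian relations make the terms linear in x₂, x₃
  -- vanish too.
  obtain ⟨p, hp⟩ : ∃ p, a 1 = 3 * p := ⟨a 1 / 3, by field_simp⟩
  obtain ⟨q, hq⟩ : ∃ q, a 2 = 3 * q := ⟨a 2 / 3, by field_simp⟩
  obtain ⟨r, hr⟩ : ∃ r, c 0 = 3 * r := ⟨c 0 / 3, by field_simp⟩
  obtain ⟨s, hs⟩ : ∃ s, c 1 = 3 * s := ⟨c 1 / 3, by field_simp⟩
  simp only [hp, hq, hr, hs] at hd0 hd1 hd2 hd3 he0 he1 he2 he3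
  have hd0' : d 0 = b 0 * r := mul_left_cancel₀ h3 (by linear_combination hd0)
  have hd1' : d 1 = 3 * p ^ 2 + b 0 * s + b 1 * r := mul_left_cancel₀ h3 (by linear_combination hd1)
  have hd2' : d 2 = 6 * p * q + b 1 * s + b 2 * r := mul_left_cancel₀ h3 (by linear_combination hd2)
  have hd3' : d 3 = 3 * q ^ 2 + b 2 * s := mul_left_cancel₀ h3 (by linear_combination hd3)
  have he0' : e 0 = 3 * r ^ 2 + p * b 0 := mul_left_cancel₀ h3 (by linear_combination he0)
  have he1' : e 1 = p * b 1 + q * b 0 + 6 * r * s := mul_left_cancel₀ h3 (by linear_combination he1)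
  have he2' : e 2 = p * b 2 + q * b 1 + 3 * s ^ 2 := mul_left_cancel₀ h3 (by linear_combination he2)
  have he3' : e 3 = q * b 2 := mul_left_cancel₀ h3 (by linear_combination he3)
  have hdet : (!![1, 0, 0, 0; 0, 1, 0, 0; -p, -q, 1, 0; -r, -s, 0, 1] :
      Matrix (Fin 4) (Fin 4) k).det ≠ 0 := by
    rw [Matrix.det_succ_row_zero]
    simp [Fin.sum_univ_four, Matrix.det_fin_three, Fin.succAbove]
  set T := Matrix.GeneralLinearGroup.mkOfDetNeZero _ hdet with hTdef
  have hTm : (T : Matrix (Fin 4) (Fin 4) k) =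
    !![1, 0, 0, 0; 0, 1, 0, 0; -p, -q, 1, 0; -r, -s, 0, 1] := rfl
  have hT : PreservesLine T := ⟨rfl, rfl, rfl, rfl⟩
  refine ⟨A * T, b, ![g 0 - r ^ 3 - b 0 * p * r,
    g 1 - p ^ 3 - 3 * r ^ 2 * s - b 0 * (p * s + q * r) - b 1 * p * r,
    g 2 - 3 * p ^ 2 * q - 3 * r * s ^ 2 - b 0 * q * s - b 1 * (p * s + q * r) - b 2 * p * r,
    g 3 - 3 * p * q ^ 2 - s ^ 3 - b 1 * q * s - b 2 * (p * s + q * r),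
    g 4 - q ^ 3 - b 2 * q * s], hA.mul hT, ?_⟩
  rw [← changeCoords_changeCoords, hG]
  refine MvPolynomial.funext fun v => ?_
  rw [eval_changeCoords, hTm]
  simp [cubesQuartic, secondKindQuartic, dotProduct, Fin.sum_univ_four, ha0, hc2,
    hp, hq, hr, hs, hd0', hd1', hd2', hd3', he0', he1', he2', he3']
  ring

/-! ### The second line. -/

theorem isAdapted_of_mem {A : GL (Fin 4) k} {m : Submodule k (Fin 4 → k)}
    (hm : Module.finrank k m = 2)
    (h2 : (A : Matrix (Fin 4) (Fin 4) k).mulVec (Pi.single 2 1) ∈ m)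
    (h3 : (A : Matrix (Fin 4) (Fin 4) k).mulVec (Pi.single 3 1) ∈ m) : IsAdapted A m := by
  have hinj : Function.Injective (A : Matrix (Fin 4) (Fin 4) k).mulVec :=
    Matrix.mulVec_injective_iff_isUnit.2 A.isUnit
  have hcomb : ∀ s t : k, s • (A : Matrix (Fin 4) (Fin 4) k).mulVec (Pi.single 2 1) +
      t • (A : Matrix (Fin 4) (Fin 4) k).mulVec (Pi.single 3 1) =
      (A : Matrix (Fin 4) (Fin 4) k).mulVec ![0, 0, s, t] := by
    intro s t
    rw [← Matrix.mulVec_smul, ← Matrix.mulVec_smul, ← Matrix.mulVec_add]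
    congr 1
    ext i
    fin_cases i <;> simp
  have hli : LinearIndependent k ![(A : Matrix (Fin 4) (Fin 4) k).mulVec (Pi.single 2 1),
      (A : Matrix (Fin 4) (Fin 4) k).mulVec (Pi.single 3 1)] := by
    rw [LinearIndependent.pair_iff]
    intro s t hst
    rw [hcomb, ← Matrix.mulVec_zero (A : Matrix (Fin 4) (Fin 4) k)] at hst
    have := hinj hst
    exact ⟨by simpa using congrFun this 2, by simpa using congrFun this 3⟩
  have hle : Submodule.span k (Set.range ![(A : Matrix (Fin 4) (Fin 4) k).mulVec (Pi.single 2 1),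
      (A : Matrix (Fin 4) (Fin 4) k).mulVec (Pi.single 3 1)]) ≤ m := by
    rw [Submodule.span_le]
    rintro _ ⟨i, rfl⟩
    fin_cases i
    · exact h2
    · exact h3
  have heq := Submodule.eq_of_le_of_finrank_eq hle (by
    rw [finrank_span_eq_card hli, hm, Fintype.card_fin])
  intro v
  constructor
  · intro hv
    rw [← heq, Matrix.range_cons, Matrix.range_cons, Matrix.range_empty, Set.union_empty,
      Set.singleton_union, Submodule.mem_span_pair] at hv
    obtain ⟨s, t, hst⟩ := hv
    rw [hcomb] at hst
    rw [← hinj hst]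
    exact ⟨rfl, rfl⟩
  · rintro ⟨hv0, hv1⟩
    have : v = ![0, 0, v 2, v 3] := by
      ext i
      fin_cases i <;> simp [hv0, hv1]
    rw [this, ← hcomb]
    exact m.add_mem (m.smul_mem _ h2) (m.smul_mem _ h3)

/-- Here `S` need not preserve x₀ = x₁ = 0. It is used to carry that line to the second one, whose α
and β are then derivatives of `G` along the first two columns of `S`. -/
theorem eval_bind₁_pderiv_changeCoords (S : GL (Fin 4) k) (G : MvPolynomial (Fin 4) k) (i : Fin 4)
    (x y : k) :
    eval ![x, y] (bind₁ ![0, 0, X 0, X 1] (pderiv i (changeCoords S G))) =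
      ∑ j, eval ((S : Matrix (Fin 4) (Fin 4) k).mulVec ![0, 0, x, y]) (pderiv j G) * S.1 j i := by
  have h : ∀ p : MvPolynomial (Fin 4) k, eval ![x, y] (bind₁ ![0, 0, X 0, X 1] p) =
      eval ![0, 0, x, y] p := by
    intro p
    rw [← aeval_eq_eval, ← aeval_eq_eval, aeval_bind₁]
    congr 2
    funext i
    fin_cases i <;> simp
  have hd : ∀ j, pderiv i (∑ j', C (S.1 j j') * X j' : MvPolynomial (Fin 4) k) = C (S.1 j i) := by
    intro j
    rw [map_sum, Finset.sum_eq_single i]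
    · simp
    · intro b _ hb
      simp [hb]
    · simp
  rw [h, changeCoords, pderiv_bind₁, map_sum]
  simp only [map_mul, hd, eval_C]
  exact Finset.sum_congr rfl fun j _ => by rw [← eval_changeCoords, changeCoords]

/-- The coefficients of a cube in the pencil `α, β`, when the values of `α, β` are known. -/
theorem CubeInPencil.coeff_eq [Infinite k] {f g : MvPolynomial (Fin 2) k} {p : Fin 2 → k}
    {a b : Fin 4 → k}
    (hf : ∀ x, eval ![x, 1] f = a 0 + a 1 * x + a 2 * x ^ 2 + a 3 * x ^ 3)
    (hg : ∀ x, eval ![x, 1] g = b 0 + b 1 * x + b 2 * x ^ 2 + b 3 * x ^ 3)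
    (h : CubeInPencil f g p) :
    ∃ s t, s * a 0 + t * b 0 = p 1 ^ 3 ∧ s * a 1 + t * b 1 = 3 * p 1 ^ 2 * p 0 ∧
      s * a 2 + t * b 2 = 3 * p 1 * p 0 ^ 2 ∧ s * a 3 + t * b 3 = p 0 ^ 3 := by
  obtain ⟨s, t, h⟩ := h
  have z := coeff_eq_zero_of_sum_eq_zero ![s * a 0 + t * b 0 - p 1 ^ 3,
    s * a 1 + t * b 1 - 3 * p 1 ^ 2 * p 0, s * a 2 + t * b 2 - 3 * p 1 * p 0 ^ 2,
    s * a 3 + t * b 3 - p 0 ^ 3] (fun x => by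
      have := congrArg (eval ![x, 1]) h
      simp only [map_add, map_mul, eval_C, hf, hg, map_pow, eval_X] at this
      simp [Fin.sum_univ_succ] at this ⊢
      linear_combination this)
  exact ⟨s, t, sub_eq_zero.1 (z 0), sub_eq_zero.1 (z 1), sub_eq_zero.1 (z 2), sub_eq_zero.1 (z 3)⟩

theorem eval_secondKindQuartic_eq_zero [Infinite k] {b : Fin 3 → k} {g : Fin 5 → k}
    {z w : Fin 4 → k} (hw0 : w 0 = 0) (hw1 : w 1 = 0)
    (h : ∀ x : k, eval (z + x • w) (secondKindQuartic b g) = 0) :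
    z 0 * w 3 ^ 3 + z 1 * w 2 ^ 3 = 0 ∧
    3 * z 0 * w 3 ^ 2 * z 3 + 3 * z 1 * w 2 ^ 2 * z 2 +
      w 2 * w 3 * (b 0 * z 0 ^ 2 + b 1 * (z 0 * z 1) + b 2 * z 1 ^ 2) = 0 ∧
    3 * z 0 * w 3 * z 3 ^ 2 + 3 * z 1 * w 2 * z 2 ^ 2 +
      (w 2 * z 3 + w 3 * z 2) * (b 0 * z 0 ^ 2 + b 1 * (z 0 * z 1) + b 2 * z 1 ^ 2) = 0 ∧
    z 0 * z 3 ^ 3 + z 1 * z 2 ^ 3 +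
      z 2 * z 3 * (b 0 * z 0 ^ 2 + b 1 * (z 0 * z 1) + b 2 * z 1 ^ 2) +
      (g 0 * z 0 ^ 4 + g 1 * (z 0 ^ 3 * z 1) + g 2 * (z 0 ^ 2 * z 1 ^ 2) + g 3 * (z 0 * z 1 ^ 3) +
        g 4 * z 1 ^ 4) = 0 := by
  have c := coeff_eq_zero_of_sum_eq_zero ![z 0 * z 3 ^ 3 + z 1 * z 2 ^ 3 +
      z 2 * z 3 * (b 0 * z 0 ^ 2 + b 1 * (z 0 * z 1) + b 2 * z 1 ^ 2) +
      (g 0 * z 0 ^ 4 + g 1 * (z 0 ^ 3 * z 1) + g 2 * (z 0 ^ 2 * z 1 ^ 2) + g 3 * (z 0 * z 1 ^ 3) +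
        g 4 * z 1 ^ 4),
    3 * z 0 * w 3 * z 3 ^ 2 + 3 * z 1 * w 2 * z 2 ^ 2 +
      (w 2 * z 3 + w 3 * z 2) * (b 0 * z 0 ^ 2 + b 1 * (z 0 * z 1) + b 2 * z 1 ^ 2),
    3 * z 0 * w 3 ^ 2 * z 3 + 3 * z 1 * w 2 ^ 2 * z 2 +
      w 2 * w 3 * (b 0 * z 0 ^ 2 + b 1 * (z 0 * z 1) + b 2 * z 1 ^ 2),
    z 0 * w 3 ^ 3 + z 1 * w 2 ^ 3] (fun x => by
      have := h x
      simp [secondKindQuartic, hw0, hw1] at this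
      simp [Fin.sum_univ_succ]
      linear_combination this)
  exact ⟨c 3, c 2, c 1, c 0⟩

/-- No pencil as below contains two independent cubes. -/
theorem false_of_cubes (h2 : (2 : k) ≠ 0) (h3 : (3 : k) ≠ 0) {ω v r κ : k} (hω : ω ≠ 0)
    {s t s' t' : k} {p q : Fin 2 → k} (hpq : p 0 * q 1 - p 1 * q 0 ≠ 0)
    (h0 : s = p 1 ^ 3) (h1 : s * ω * r - 3 * ω ^ 3 * t = 3 * p 1 ^ 2 * p 0)
    (h2' : s * v * r - 3 * ω ^ 2 * v * t = 3 * p 1 * p 0 ^ 2)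
    (h3' : s * κ - 3 * ω * v ^ 2 * t = p 0 ^ 3)
    (i0 : s' = q 1 ^ 3) (i1 : s' * ω * r - 3 * ω ^ 3 * t' = 3 * q 1 ^ 2 * q 0)
    (i2 : s' * v * r - 3 * ω ^ 2 * v * t' = 3 * q 1 * q 0 ^ 2)
    (i3 : s' * κ - 3 * ω * v ^ 2 * t' = q 0 ^ 3) : False := by
  -- No cube in the pencil is a multiple of x³: such a member would have s = 0, and then t = 0.
  have nonzero : ∀ {s t x y : k}, s = y ^ 3 → s * ω * r - 3 * ω ^ 3 * t = 3 * y ^ 2 * x →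
      s * κ - 3 * ω * v ^ 2 * t = x ^ 3 → y = 0 → x = 0 := by
    rintro s t x y e0 e1 e3 rfl
    have hs : s = 0 := by rw [e0]; ring
    rw [hs] at e1 e3
    have ht : t = 0 := by
      refine (mul_eq_zero.1 (?_ : (3 * ω ^ 3) * t = 0)).resolve_left
        (mul_ne_zero h3 (pow_ne_zero _ hω))
      linear_combination -e1
    rw [ht] at e3
    exact pow_eq_zero_iff (n := 3) (by norm_num) |>.1 (by linear_combination -e3)
  have hp1 : p 1 ≠ 0 := fun h => hpq (by rw [nonzero h0 h1 h3' h, h]; ring)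
  have hq1 : q 1 ≠ 0 := fun h => hpq (by rw [nonzero i0 i1 i3 h, h]; ring)
  -- The two middle coefficients of every member are in the ratio ω : v, while those of a cube are
  -- in the ratio y : x unless both vanish.
  have dich : ∀ {s t x y : k}, y ≠ 0 → s * ω * r - 3 * ω ^ 3 * t = 3 * y ^ 2 * x →
      s * v * r - 3 * ω ^ 2 * v * t = 3 * y * x ^ 2 → x = 0 ∨ v * y = ω * x := by
    intro s t x y hy e1 e2
    have : (3 * y) * (x * (v * y - ω * x)) = 0 := by linear_combination ω * e2 - v * e1
    rcases mul_eq_zero.1 ((mul_eq_zero.1 this).resolve_left (mul_ne_zero h3 hy)) with h | h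
    · exact Or.inl h
    · exact Or.inr (sub_eq_zero.1 h)
  -- Subtracting a multiple of the constant cube y³ from the other cube leaves a multiple of β.
  -- Comparing its coefficients of x and x³ gives 3v²y'² = ω²x'², against v y' = ω x' in
  -- characteristic different from 2.
  have final : ∀ {s t s' t' y x' y' : k}, y ≠ 0 → x' ≠ 0 → y' ≠ 0 → v * y' = ω * x' →
      s = y ^ 3 → s * ω * r - 3 * ω ^ 3 * t = 0 → s * κ - 3 * ω * v ^ 2 * t = 0 →
      s' * ω * r - 3 * ω ^ 3 * t' = 3 * y' ^ 2 * x' →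
      s' * κ - 3 * ω * v ^ 2 * t' = x' ^ 3 → False := by
    intro s t s' t' y x' y' hy hx' hy' hv e0 e1 e3 e1' e3'
    have hs : s ≠ 0 := by rw [e0]; exact pow_ne_zero _ hy
    have : (2 * s * x') * (ω * x') ^ 2 = 0 := by
      linear_combination s * ω ^ 2 * e3' - s' * ω ^ 2 * e3 - s * v ^ 2 * e1' + s' * v ^ 2 * e1 - 3 * s * x' * (v * y' + ω * x') * hv
    exact mul_ne_zero (mul_ne_zero (mul_ne_zero h2 hs) hx') (pow_ne_zero 2 (mul_ne_zero hω hx')) this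
  rcases dich hp1 h1 h2' with hp | hp <;> rcases dich hq1 i1 i2 with hq | hq
  · exact hpq (by rw [hp, hq]; ring)
  · have hq0 : q 0 ≠ 0 := fun h => hpq (by rw [hp, h]; ring)
    exact final hp1 hq0 hq1 hq h0 (by rw [h1, hp]; ring) (by rw [h3', hp]; ring) i1 i3
  · have hp0 : p 0 ≠ 0 := fun h => hpq (by rw [hq, h]; ring)
    exact final hq1 hp0 hp1 hp i0 (by rw [i1, hq]; ring) (by rw [i3, hq]; ring) h1 h3'
  · refine hpq ((mul_eq_zero.1 (?_ : ω * _ = 0)).resolve_left hω)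
    linear_combination p 1 * hq - q 1 * hp

/-- The conclusions of `adapted_of_secondKind` for all adapted coordinates. -/
def IsCubicLine (F : MvPolynomial (Fin 4) k) (m : Submodule k (Fin 4 → k)) : Prop :=
  ∀ A : GL (Fin 4) k, IsAdapted A m → ContainsLine (changeCoords A F) ∧
    TwoCubes (alpha (changeCoords A F)) (beta (changeCoords A F)) ∧
    HessianVanishes (changeCoords A F)

theorem IsCubicLine.of_changeCoords {F : MvPolynomial (Fin 4) k} {m : Submodule k (Fin 4 → k)}
    (h : IsCubicLine F m) (hm : Module.finrank k m = 2) (B S : GL (Fin 4) k)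
    (h2 : (B : Matrix (Fin 4) (Fin 4) k).mulVec (S.1.col 2) ∈ m)
    (h3 : (B : Matrix (Fin 4) (Fin 4) k).mulVec (S.1.col 3) ∈ m) :
    ContainsLine (changeCoords S (changeCoords B F)) ∧
    TwoCubes (alpha (changeCoords S (changeCoords B F)))
      (beta (changeCoords S (changeCoords B F))) ∧
    HessianVanishes (changeCoords S (changeCoords B F)) := by
  rw [changeCoords_changeCoords]
  refine h _ (isAdapted_of_mem hm ?_ ?_)
  · rwa [Units.val_mul, ← Matrix.mulVec_mulVec, Matrix.mulVec_single_one]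
  · rwa [Units.val_mul, ← Matrix.mulVec_mulVec, Matrix.mulVec_single_one]

/-- A line meeting `x₀ = x₁ = 0` outside its ramification points is not totally ramified at two
points. -/
theorem false_of_general_line [Infinite k] (h2 : (2 : k) ≠ 0) (h3 : (3 : k) ≠ 0)
    {F : MvPolynomial (Fin 4) k} {m : Submodule k (Fin 4 → k)} (hm : Module.finrank k m = 2)
    (hcubic : IsCubicLine F m) {B : GL (Fin 4) k} {b : Fin 3 → k} {g : Fin 5 → k}
    (hB : changeCoords B F = secondKindQuartic b g) {ω v : k} (hω : ω ≠ 0)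
    (hz : (B : Matrix (Fin 4) (Fin 4) k).mulVec ![-ω ^ 3, 1, v, 0] ∈ m)
    (hw : (B : Matrix (Fin 4) (Fin 4) k).mulVec ![0, 0, ω, 1] ∈ m)
    (hQ : b 0 * (-ω ^ 3) ^ 2 + b 1 * (-ω ^ 3) + b 2 = -3 * ω * v) : False := by
  -- The last two columns span m; the first two, e₀ and e₃, complete them to a frame.
  have hdet : (!![1, 0, -ω ^ 3, 0; 0, 0, 1, 0; 0, 0, v, ω; 0, 1, 0, 1] :
      Matrix (Fin 4) (Fin 4) k).det ≠ 0 := by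
    rw [Matrix.det_succ_row_zero]
    simpa [Fin.sum_univ_four, Matrix.det_fin_three, Fin.succAbove] using hω
  obtain ⟨S, hS⟩ : ∃ S : GL (Fin 4) k, (S : Matrix (Fin 4) (Fin 4) k) =
      !![1, 0, -ω ^ 3, 0; 0, 0, 1, 0; 0, 0, v, ω; 0, 1, 0, 1] :=
    ⟨Matrix.GeneralLinearGroup.mkOfDetNeZero _ hdet, rfl⟩
  have c2 : S.1.col 2 = ![-ω ^ 3, 1, v, 0] := by
    rw [hS]; ext i; fin_cases i <;> rfl
  have c3 : S.1.col 3 = ![0, 0, ω, 1] := by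
    rw [hS]; ext i; fin_cases i <;> rfl
  obtain ⟨hl, ⟨p, q, hpq, hp, hq⟩, -⟩ :=
    hcubic.of_changeCoords hm B S (by rwa [c2]) (by rwa [c3])
  have hvec : ∀ x y : k, (S : Matrix (Fin 4) (Fin 4) k).mulVec ![0, 0, x, y] =
      ![-ω ^ 3 * x, x, v * x + ω * y, y] := by
    intro x y
    rw [hS]
    ext i
    fin_cases i <;> simp [Matrix.mulVec, dotProduct, Fin.sum_univ_four]
  have h3C : ∀ i, pderiv i (3 : MvPolynomial (Fin 4) k) = 0 := fun i => pderiv_C (a := 3)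
  set r := b 0 * (2 * -ω ^ 3) + b 1 with hr
  set κ := 4 * g 0 * (-ω ^ 3) ^ 3 + 3 * g 1 * (-ω ^ 3) ^ 2 + 2 * g 2 * -ω ^ 3 + g 3 with hκ
  have hα : ∀ x, eval ![x, 1] (alpha (changeCoords S (changeCoords B F))) =
      (![1, ω * r, v * r, κ] : Fin 4 → k) 0 + (![1, ω * r, v * r, κ] : Fin 4 → k) 1 * x +
      (![1, ω * r, v * r, κ] : Fin 4 → k) 2 * x ^ 2 +
      (![1, ω * r, v * r, κ] : Fin 4 → k) 3 * x ^ 3 := by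
    intro x
    rw [alpha_eq hl, eval_bind₁_pderiv_changeCoords, hvec, hB, Fin.sum_univ_four, hS]
    simp [secondKindQuartic, pderiv_X, Derivation.leibniz, Derivation.leibniz_pow]
    rw [hr, hκ]
    ring
  have hβ : ∀ x, eval ![x, 1] (beta (changeCoords S (changeCoords B F))) =
      (![0, -3 * ω ^ 3, -3 * ω ^ 2 * v, -3 * ω * v ^ 2] : Fin 4 → k) 0 +
      (![0, -3 * ω ^ 3, -3 * ω ^ 2 * v, -3 * ω * v ^ 2] : Fin 4 → k) 1 * x +
      (![0, -3 * ω ^ 3, -3 * ω ^ 2 * v, -3 * ω * v ^ 2] : Fin 4 → k) 2 * x ^ 2 +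
      (![0, -3 * ω ^ 3, -3 * ω ^ 2 * v, -3 * ω * v ^ 2] : Fin 4 → k) 3 * x ^ 3 := by
    intro x
    rw [beta_eq hl, eval_bind₁_pderiv_changeCoords, hvec, hB, Fin.sum_univ_four, hS]
    simp [secondKindQuartic, pderiv_X, Derivation.leibniz, Derivation.leibniz_pow]
    linear_combination x ^ 2 * (v * x + ω) * hQ
  obtain ⟨s, t, e0, e1, e2, e3⟩ := hp.coeff_eq hα hβ
  obtain ⟨s', t', i0, i1, i2, i3⟩ := hq.coeff_eq hα hβ
  simp at e0 e1 e2 e3 i0 i1 i2 i3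
  exact false_of_cubes h2 h3 hω hpq (v := v) (r := r) (κ := κ) (s := s) (t := t) (s' := s')
    (t' := t') e0 (by linear_combination e1) (by linear_combination e2) (by linear_combination e3)
    i0 (by linear_combination i1) (by linear_combination i2) (by linear_combination i3)

/-- Along m the pencil is spanned by 1 + v b₁x² + g₃x³ and b₂x² + 3v²x³. No member has a term in x,
so the two cubes must be multiples of 1 and of x³; each then kills one of the coefficients of x². -/
theorem coeff_of_special_line_of_twoCubes [Infinite k] (h3 : (3 : k) ≠ 0)
    {F : MvPolynomial (Fin 4) k} {m : Submodule k (Fin 4 → k)} (hm : Module.finrank k m = 2)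
    (hcubic : IsCubicLine F m) {B : GL (Fin 4) k} {b : Fin 3 → k} {g : Fin 5 → k}
    (hB : changeCoords B F = secondKindQuartic b g) {v : k}
    (hz : (B : Matrix (Fin 4) (Fin 4) k).mulVec ![0, 1, v, 0] ∈ m)
    (hw : (B : Matrix (Fin 4) (Fin 4) k).mulVec ![0, 0, 0, 1] ∈ m) :
    v ≠ 0 ∧ b 1 = 0 ∧ b 2 = 0 := by
  have hdet : (!![1, 0, 0, 0; 0, 0, 1, 0; 0, 1, v, 0; 0, 0, 0, 1] :
      Matrix (Fin 4) (Fin 4) k).det ≠ 0 := by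
    rw [Matrix.det_succ_row_zero]
    simp [Fin.sum_univ_four, Matrix.det_fin_three, Fin.succAbove]
  obtain ⟨S, hS⟩ : ∃ S : GL (Fin 4) k, (S : Matrix (Fin 4) (Fin 4) k) =
      !![1, 0, 0, 0; 0, 0, 1, 0; 0, 1, v, 0; 0, 0, 0, 1] :=
    ⟨Matrix.GeneralLinearGroup.mkOfDetNeZero _ hdet, rfl⟩
  have c2 : S.1.col 2 = ![0, 1, v, 0] := by
    rw [hS]; ext i; fin_cases i <;> rfl
  have c3 : S.1.col 3 = ![0, 0, 0, 1] := by
    rw [hS]; ext i; fin_cases i <;> rfl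
  obtain ⟨hl, ⟨p, q, hpq, hp, hq⟩, -⟩ :=
    hcubic.of_changeCoords hm B S (by rwa [c2]) (by rwa [c3])
  have hvec : ∀ x y : k, (S : Matrix (Fin 4) (Fin 4) k).mulVec ![0, 0, x, y] =
      ![0, x, v * x, y] := by
    intro x y
    rw [hS]
    ext i
    fin_cases i <;> simp [Matrix.mulVec, dotProduct, Fin.sum_univ_four]
  have hα : ∀ x, eval ![x, 1] (alpha (changeCoords S (changeCoords B F))) =
      (![1, 0, v * b 1, g 3] : Fin 4 → k) 0 + (![1, 0, v * b 1, g 3] : Fin 4 → k) 1 * x +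
      (![1, 0, v * b 1, g 3] : Fin 4 → k) 2 * x ^ 2 +
      (![1, 0, v * b 1, g 3] : Fin 4 → k) 3 * x ^ 3 := by
    intro x
    rw [alpha_eq hl, eval_bind₁_pderiv_changeCoords, hvec, hB, Fin.sum_univ_four, hS]
    simp [secondKindQuartic, pderiv_X, Derivation.leibniz, Derivation.leibniz_pow]
    ring
  have hβ : ∀ x, eval ![x, 1] (beta (changeCoords S (changeCoords B F))) =
      (![0, 0, b 2, 3 * v ^ 2] : Fin 4 → k) 0 + (![0, 0, b 2, 3 * v ^ 2] : Fin 4 → k) 1 * x +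
      (![0, 0, b 2, 3 * v ^ 2] : Fin 4 → k) 2 * x ^ 2 +
      (![0, 0, b 2, 3 * v ^ 2] : Fin 4 → k) 3 * x ^ 3 := by
    intro x
    rw [beta_eq hl, eval_bind₁_pderiv_changeCoords, hvec, hB, Fin.sum_univ_four, hS]
    simp [secondKindQuartic, pderiv_X, Derivation.leibniz, Derivation.leibniz_pow]
    ring
  obtain ⟨s, t, e0, e1, e2, e3⟩ := hp.coeff_eq hα hβ
  obtain ⟨s', t', i0, i1, i2, i3⟩ := hq.coeff_eq hα hβ
  simp [h3] at e0 e1 e2 e3 i0 i1 i2 i3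
  have key : ∀ {s t s' t' x y : k}, x ≠ 0 → y ≠ 0 → s = 0 → s * (v * b 1) + t * b 2 = 0 →
      s * g 3 + t * (3 * v ^ 2) = x ^ 3 → s' = y ^ 3 → s' * (v * b 1) + t' * b 2 = 0 →
      v ≠ 0 ∧ b 1 = 0 ∧ b 2 = 0 := by
    rintro s t s' t' x y hx hy rfl e2 e3 i0 i2
    rw [zero_mul, zero_add] at e2 e3
    have hne : t * (3 * v ^ 2) ≠ 0 := e3 ▸ pow_ne_zero 3 hx
    have ht : t ≠ 0 := left_ne_zero_of_mul hne
    have hv : v ≠ 0 := fun hv => right_ne_zero_of_mul hne (by rw [hv]; ring)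
    have hb2 : b 2 = 0 := (mul_eq_zero.1 e2).resolve_left ht
    rw [hb2, mul_zero, add_zero] at i2
    have hs' : s' ≠ 0 := i0 ▸ pow_ne_zero 3 hy
    exact ⟨hv, (mul_eq_zero.1 ((mul_eq_zero.1 i2).resolve_left hs')).resolve_left hv, hb2⟩
  rcases e1 with hp1 | hp0
  · have hp0 : p 0 ≠ 0 := fun h => hpq (by rw [h, hp1]; ring)
    have hq1 : q 1 ≠ 0 := fun h => hpq (by rw [h, hp1]; ring)
    have hq0 := i1.resolve_left hq1
    exact key hp0 hq1 (by rw [e0, hp1]; ring) (by rw [e2, hp1]; ring) e3 i0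
      (by rw [i2, hq0]; ring)
  · have hp1 : p 1 ≠ 0 := fun h => hpq (by rw [h, hp0]; ring)
    have hq0 : q 0 ≠ 0 := fun h => hpq (by rw [h, hp0]; ring)
    have hq1 := i1.resolve_right hq0
    exact key hq0 hp1 (by rw [i0, hq1]; ring) (by rw [i2, hq1]; ring) i3 e0
      (by rw [e2, hp0]; ring)

/-- With b₁ = b₂ = 0 an explicit frame brings m to the form `cubesQuartic`; the hessian relations
for m then remove the remaining coefficients. -/
theorem coeff_of_special_line [Infinite k] (h2 : (2 : k) ≠ 0) (h3 : (3 : k) ≠ 0)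
    {F : MvPolynomial (Fin 4) k} {m : Submodule k (Fin 4 → k)} (hm : Module.finrank k m = 2)
    (hcubic : IsCubicLine F m) {B : GL (Fin 4) k} {b : Fin 3 → k} {g : Fin 5 → k}
    (hB : changeCoords B F = secondKindQuartic b g) {v : k}
    (hz : (B : Matrix (Fin 4) (Fin 4) k).mulVec ![0, 1, v, 0] ∈ m)
    (hw : (B : Matrix (Fin 4) (Fin 4) k).mulVec ![0, 0, 0, 1] ∈ m) (hg4 : g 4 = -v ^ 3) :
    v ≠ 0 ∧ b = 0 ∧ g = ![g 0, 0, 0, 0, -v ^ 3] := by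
  obtain ⟨hv, hb1, hb2⟩ := coeff_of_special_line_of_twoCubes h3 hm hcubic hB hz hw
  obtain ⟨τ, hτ⟩ : ∃ τ, 3 * v ^ 2 * τ = 1 :=
    ⟨(3 * v ^ 2)⁻¹, mul_inv_cancel₀ (mul_ne_zero h3 (pow_ne_zero 2 hv))⟩
  have hτ0 : τ ≠ 0 := right_ne_zero_of_mul (hτ ▸ one_ne_zero)
  -- The entry τ = 1/(3v²) normalises β to x₂³, and -τg₃ removes the term g₃x₂³ from α.
  have hdet : (!![1, 0, 0, 0; 0, 0, 1, 0; -τ * g 3, τ, v, 0; 0, 0, 0, 1] :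
      Matrix (Fin 4) (Fin 4) k).det ≠ 0 := by
    rw [Matrix.det_succ_row_zero]
    simpa [Fin.sum_univ_four, Matrix.det_fin_three, Fin.succAbove] using hτ0
  obtain ⟨S, hS⟩ : ∃ S : GL (Fin 4) k, (S : Matrix (Fin 4) (Fin 4) k) =
      !![1, 0, 0, 0; 0, 0, 1, 0; -τ * g 3, τ, v, 0; 0, 0, 0, 1] :=
    ⟨Matrix.GeneralLinearGroup.mkOfDetNeZero _ hdet, rfl⟩
  have c2 : S.1.col 2 = ![0, 1, v, 0] := by
    rw [hS]; ext i; fin_cases i <;> rfl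
  have c3 : S.1.col 3 = ![0, 0, 0, 1] := by
    rw [hS]; ext i; fin_cases i <;> rfl
  obtain ⟨-, -, hH⟩ := hcubic.of_changeCoords hm B S (by rwa [c2]) (by rwa [c3])
  have hG : changeCoords S (changeCoords B F) = cubesQuartic
      ![3 * v * τ ^ 2 * g 3 ^ 2 + g 2, -6 * v * τ ^ 2 * g 3, 3 * v * τ ^ 2] ![b 0 * v, 0, 0] 0
      ![-τ ^ 3 * g 3 ^ 3 + g 1, 3 * τ ^ 3 * g 3 ^ 2, -3 * τ ^ 3 * g 3, τ ^ 3]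
      ![-b 0 * τ * g 3, b 0 * τ, 0, 0] ![g 0, 0, 0, 0, 0] := by
    refine MvPolynomial.funext fun x => ?_
    rw [eval_changeCoords, hB, hS]
    simp [cubesQuartic, secondKindQuartic, dotProduct, Fin.sum_univ_four, hb1, hb2, hg4]
    linear_combination (x 2 ^ 3 * (x 1 - g 3 * x 0)) * hτ
  rw [hG] at hH
  obtain ⟨ha0, -, hd0, hd1, -, -, -, he1, -, -⟩ := hessianVanishes_cubesQuartic h2 h3 hH
  simp at ha0 hd0 hd1 he1
  have hg3 : g 3 = 0 := by
    have : 3 * τ ^ 3 * g 3 ^ 2 = 0 := by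
      linear_combination -hd1 - 12 * τ ^ 3 * g 3 ^ 2 * hτ
    exact pow_eq_zero_iff (n := 2) (by norm_num) |>.1
      ((mul_eq_zero.1 this).resolve_left (mul_ne_zero h3 (pow_ne_zero 3 hτ0)))
  have hb0 : b 0 = 0 := by
    have : 2 * τ * b 0 = 0 := by linear_combination he1 + b 0 * τ * hτ
    exact (mul_eq_zero.1 this).resolve_left (mul_ne_zero h2 hτ0)
  rw [hg3] at ha0 hd0
  simp [h3] at ha0 hd0
  refine ⟨hv, ?_, ?_⟩
  · ext i
    fin_cases i
    · exact hb0
    · exact hb1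
    · exact hb2
  · ext i
    fin_cases i
    · rfl
    · exact hd0
    · exact ha0
    · exact hg3
    · exact hg4

/-- The map defined by l is ramified at [1:0] and [0:1]. Since z₁ ≠ 0, m cannot pass through the
first; it passes through the second exactly when ω = 0. -/
theorem coeff_of_second_line [Infinite k] (h2 : (2 : k) ≠ 0) (h3 : (3 : k) ≠ 0)
    {F : MvPolynomial (Fin 4) k} {m : Submodule k (Fin 4 → k)} (hm : IsLineOn F m)
    (hcubic : IsCubicLine F m) {B : GL (Fin 4) k} {b : Fin 3 → k} {g : Fin 5 → k}
    (hB : changeCoords B F = secondKindQuartic b g) {z w : Fin 4 → k}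
    (hz : (B : Matrix (Fin 4) (Fin 4) k).mulVec z ∈ m)
    (hw : (B : Matrix (Fin 4) (Fin 4) k).mulVec w ∈ m)
    (hw_ne : w ≠ 0) (hw0 : w 0 = 0) (hw1 : w 1 = 0) (hz1 : z 1 ≠ 0) :
    ∃ v g₀, v ≠ 0 ∧ b = 0 ∧ g = ![g₀, 0, 0, 0, -v ^ 3] := by
  have hvan : ∀ z w, (B : Matrix (Fin 4) (Fin 4) k).mulVec z ∈ m →
      (B : Matrix (Fin 4) (Fin 4) k).mulVec w ∈ m → ∀ x : k,
      eval (z + x • w) (secondKindQuartic b g) = 0 := by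
    intro z w hz hw x
    rw [← hB, eval_changeCoords]
    refine hm.2 _ ?_
    rw [Matrix.mulVec_add, Matrix.mulVec_smul]
    exact m.add_mem hz (m.smul_mem _ hw)
  have hw3 : w 3 ≠ 0 := by
    intro hw3
    have h := (eval_secondKindQuartic_eq_zero hw0 hw1 (hvan z w hz hw)).1
    rw [hw3] at h
    have hw2 : w 2 = 0 := by
      refine pow_eq_zero_iff (n := 3) (by norm_num) |>.1 ((mul_eq_zero.1 ?_).resolve_left hz1)
      linear_combination h
    refine hw_ne (funext fun i => ?_)
    fin_cases i
    · exact hw0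
    · exact hw1
    · exact hw2
    · exact hw3
  -- The line m is spanned by (0, 0, ω, 1) and (z₀/z₁, 1, v, 0).
  obtain ⟨ω, hω⟩ : ∃ ω, ω = w 2 / w 3 := ⟨_, rfl⟩
  obtain ⟨v, hv⟩ : ∃ v, v = (z 2 - z 3 * ω) / z 1 := ⟨_, rfl⟩
  have hw' : (B : Matrix (Fin 4) (Fin 4) k).mulVec ![0, 0, ω, 1] ∈ m := by
    have : ![0, 0, ω, 1] = (w 3)⁻¹ • w := by
      ext i
      fin_cases i
      · simp [hw0]
      · simp [hw1]
      · simp [hω]; field_simp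
      · simp [hw3]
    rw [this, Matrix.mulVec_smul]
    exact m.smul_mem _ hw
  have hz' : (B : Matrix (Fin 4) (Fin 4) k).mulVec ![z 0 / z 1, 1, v, 0] ∈ m := by
    have : ![z 0 / z 1, 1, v, 0] = (z 1)⁻¹ • (z - z 3 • ![0, 0, ω, 1]) := by
      ext i
      fin_cases i
      · change z 0 / z 1 = (z 1)⁻¹ * (z 0 - z 3 * 0)
        ring
      · change 1 = (z 1)⁻¹ * (z 1 - z 3 * 0)
        rw [mul_zero, sub_zero, inv_mul_cancel₀ hz1]
      · change v = (z 1)⁻¹ * (z 2 - z 3 * ω)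
        rw [hv]; ring
      · change 0 = (z 1)⁻¹ * (z 3 - z 3 * 1)
        ring
    rw [this, Matrix.mulVec_smul, Matrix.mulVec_sub, Matrix.mulVec_smul]
    exact m.smul_mem _ (m.sub_mem hz (m.smul_mem _ hw'))
  obtain ⟨e3, e2, e1, e0⟩ := eval_secondKindQuartic_eq_zero (z := ![z 0 / z 1, 1, v, 0])
    (w := ![0, 0, ω, 1]) rfl rfl (hvan _ _ hz' hw')
  have hζ : z 0 / z 1 = -ω ^ 3 := by
    simp at e3
    linear_combination e3
  rw [hζ] at hz' e3 e2 e1 e0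
  simp at e3 e2 e1 e0
  by_cases hω0 : ω = 0
  · subst hω0
    simp at hz' e0
    obtain ⟨hv0, hb, hg⟩ := coeff_of_special_line h2 h3 hm.1 hcubic hB hz' hw'
      (by linear_combination e0)
    exact ⟨v, g 0, hv0, hb, hg⟩
  · exfalso
    refine false_of_general_line h2 h3 hm.1 hcubic hB hω0 hz' hw' (mul_left_cancel₀ hω0 ?_)
    linear_combination e2

theorem changeCoords_swap [Infinite k] (b : Fin 3 → k) (g : Fin 5 → k) :
    ∃ S : GL (Fin 4) k, PreservesLine S ∧
      (∀ v, (S : Matrix (Fin 4) (Fin 4) k).mulVec v = ![v 1, v 0, v 3, v 2]) ∧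
      changeCoords S (secondKindQuartic b g) =
        secondKindQuartic ![b 2, b 1, b 0] ![g 4, g 3, g 2, g 1, g 0] := by
  have hdet : (!![0, 1, 0, 0; 1, 0, 0, 0; 0, 0, 0, 1; 0, 0, 1, 0] :
      Matrix (Fin 4) (Fin 4) k).det ≠ 0 := by
    rw [Matrix.det_succ_row_zero]
    simp [Fin.sum_univ_four, Matrix.det_fin_three, Fin.succAbove]
  have hS : ∀ v : Fin 4 → k, (!![0, 1, 0, 0; 1, 0, 0, 0; 0, 0, 0, 1; 0, 0, 1, 0] :
      Matrix (Fin 4) (Fin 4) k).mulVec v = ![v 1, v 0, v 3, v 2] := by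
    intro v
    ext i
    fin_cases i <;> simp [Matrix.mulVec, dotProduct, Fin.sum_univ_four]
  refine ⟨Matrix.GeneralLinearGroup.mkOfDetNeZero _ hdet, ⟨rfl, rfl, rfl, rfl⟩, hS, ?_⟩
  refine MvPolynomial.funext fun v => ?_
  rw [eval_changeCoords]
  refine (congrArg (fun u => eval u _) (hS v)).trans ?_
  simp [secondKindQuartic]
  ring

theorem exists_diagonal_form [IsAlgClosed k] (h2 : (2 : k) ≠ 0) (h3 : (3 : k) ≠ 0)
    {F : MvPolynomial (Fin 4) k} (hF : F.IsHomogeneous 4) {l m : Submodule k (Fin 4 → k)}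
    (hl : IsLineOn F l) (hm : IsLineOn F m) (hne : l ≠ m) (hinter : l ⊓ m ≠ ⊥)
    (hdegl : HasDegree F l 3) (hdegm : HasDegree F m 3)
    (hraml : HasRamificationCount F l 2) (hramm : HasRamificationCount F m 2)
    (hkindl : IsSecondKind F l) (hkindm : IsSecondKind F m) :
    ∃ (B : GL (Fin 4) k) (v g₀ : k), v ≠ 0 ∧
      changeCoords B F = secondKindQuartic 0 ![g₀, 0, 0, 0, -v ^ 3] := by
  have : Infinite k := IsAlgClosed.instInfinite
  have hcubic : IsCubicLine F m := fun A hA =>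
    adapted_of_secondKind h2 h3 hF hm hdegm hramm hkindm hA
  obtain ⟨B, b, g, hBl, hB⟩ := exists_secondKindQuartic h2 h3 hF hl hdegl hraml hkindl
  have hinv : ∀ x, (B : Matrix (Fin 4) (Fin 4) k).mulVec
      (((B⁻¹ : GL (Fin 4) k) : Matrix (Fin 4) (Fin 4) k).mulVec x) = x := by
    intro x
    rw [Matrix.mulVec_mulVec, ← Units.val_mul, mul_inv_cancel, Units.val_one, Matrix.one_mulVec]
  obtain ⟨x, ⟨hxl, hxm⟩, hx0⟩ := Submodule.exists_mem_ne_zero_of_ne_bot hinter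
  obtain ⟨y, hym, hyl⟩ : ∃ y ∈ m, y ∉ l := by
    by_contra! h
    exact hne (Submodule.eq_of_le_of_finrank_eq (h : m ≤ l) (by rw [hl.1, hm.1])).symm
  obtain ⟨w, rfl⟩ : ∃ w, (B : Matrix (Fin 4) (Fin 4) k).mulVec w = x := ⟨_, hinv x⟩
  obtain ⟨z, rfl⟩ : ∃ z, (B : Matrix (Fin 4) (Fin 4) k).mulVec z = y := ⟨_, hinv y⟩
  obtain ⟨hw0, hw1⟩ := (hBl w).1 hxl
  have hw_ne : w ≠ 0 := by
    rintro rfl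
    exact hx0 (Matrix.mulVec_zero _)
  -- If z₁ = 0 then z₀ ≠ 0, and the symmetry x₀ ↔ x₁, x₂ ↔ x₃ of the normal form reduces to the
  -- other case.
  by_cases hz1 : z 1 = 0
  · have hz0 : z 0 ≠ 0 := fun hz0 => hyl ((hBl z).2 ⟨hz0, hz1⟩)
    obtain ⟨S, hS, hSv, hSG⟩ := changeCoords_swap b g
    rw [← hB, changeCoords_changeCoords] at hSG
    have hmul : ∀ u, ((B * S : GL (Fin 4) k) : Matrix (Fin 4) (Fin 4) k).mulVec
        ![u 1, u 0, u 3, u 2] = (B : Matrix (Fin 4) (Fin 4) k).mulVec u := by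
      intro u
      rw [Units.val_mul, ← Matrix.mulVec_mulVec, hSv]
      congr 1
      ext i
      fin_cases i <;> rfl
    obtain ⟨v, g₀, hv, hb, hg⟩ := coeff_of_second_line h2 h3 hm hcubic hSG
      (z := ![z 1, z 0, z 3, z 2]) (w := ![w 1, w 0, w 3, w 2]) (by rwa [hmul]) (by rwa [hmul])
      (by
        intro h
        refine hw_ne (funext fun i => ?_)
        fin_cases i
        · exact congrFun h 1
        · exact congrFun h 0
        · exact congrFun h 3
        · exact congrFun h 2) hw1 hw0 hz0
    exact ⟨B * S, v, g₀, hv, by rw [hSG, hb, hg]⟩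
  · obtain ⟨v, g₀, hv, hb, hg⟩ := coeff_of_second_line h2 h3 hm hcubic hB hym hxm hw_ne hw0 hw1 hz1
    exact ⟨B, v, g₀, hv, by rw [hB, hb, hg]⟩

/-! ### Exclusion of a triple point. -/

theorem order_le_two_of_ADENormalForm {g : MvPolynomial (Fin 3) k} (hg : ADENormalForm g) :
    (g : MvPowerSeries (Fin 3) k).order ≤ 2 := by
  have key : ∀ d : Fin 3 →₀ ℕ, d.degree = 2 → coeff d g ≠ 0 →
      (g : MvPowerSeries (Fin 3) k).order ≤ 2 := by
    intro d hd hc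
    have := MvPowerSeries.order_le (f := (g : MvPowerSeries (Fin 3) k)) (d := d)
      (by rwa [MvPolynomial.coeff_coe])
    rwa [hd] at this
  have hA : ∀ q : MvPolynomial (Fin 3) k,
      coeff (Finsupp.single 0 1 + Finsupp.single 1 1) (X 0 * X 1 + X 2 * q) = 1 := by
    intro q
    rw [coeff_add, coeff_X_mul', if_pos (by simp), coeff_X_mul', if_neg (by simp), add_zero,
      add_tsub_cancel_left, coeff_X, if_pos rfl]
  have hDE : ∀ p q : MvPolynomial (Fin 3) k,
      coeff (Finsupp.single 0 2) (X 0 ^ 2 + (X 1 * p + X 2 * q)) = 1 := by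
    intro p q
    rw [coeff_add, coeff_add, coeff_X_mul', if_neg (by simp), coeff_X_mul',
      if_neg (by simp), coeff_X_pow, if_pos rfl, add_zero, add_zero]
  have hDE' : ∀ p q : MvPolynomial (Fin 3) k, g = X 0 ^ 2 + (X 1 * p + X 2 * q) →
      (g : MvPowerSeries (Fin 3) k).order ≤ 2 := fun p q h =>
    key (Finsupp.single 0 2) (by simp) (by rw [h, hDE]; exact one_ne_zero)
  cases hg with
  | A n hn =>
    refine key (Finsupp.single 0 1 + Finsupp.single 1 1) (by simp) ?_
    rw [pow_succ', hA]
    exact one_ne_zero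
  | D n hn =>
    obtain ⟨j, rfl⟩ := Nat.exists_eq_add_of_le hn
    exact hDE' (X 1 * X 2) (X 2 ^ (j + 2)) (by
      rw [show 4 + j - 1 = j + 2 + 1 by omega, pow_succ']; ring)
  | E6 => exact hDE' (X 1 ^ 2) (X 2 ^ 3) (by ring)
  | E7 => exact hDE' (X 1 ^ 2 + X 2 ^ 3) 0 (by ring)
  | E8 => exact hDE' (X 1 ^ 2) (X 2 ^ 4) (by ring)
  | E8' => exact hDE' (X 1 ^ 2 + X 2 ^ 4) (X 2 ^ 4) (by ring)

/-- An automorphism preserves non-units, hence the maximal ideal of series without constant term; no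
continuity is needed. -/
theorem one_le_order_algEquiv (φ : MvPowerSeries (Fin 3) k ≃ₐ[k] MvPowerSeries (Fin 3) k)
    {x : MvPowerSeries (Fin 3) k} (hx : MvPowerSeries.constantCoeff x = 0) : 1 ≤ (φ x).order := by
  rw [MvPowerSeries.one_le_order_iff_constCoeff_eq_zero]
  by_contra h
  have hu : IsUnit (φ x) := MvPowerSeries.isUnit_iff_constantCoeff.2 (Ne.isUnit h)
  have hu' := hu.map φ.symm
  rw [φ.symm_apply_apply] at hu'
  have := MvPowerSeries.isUnit_iff_constantCoeff.1 hu'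
  rw [hx] at this
  exact not_isUnit_zero this

theorem three_le_order {x y z t : MvPowerSeries (Fin 3) k} (hx : 1 ≤ x.order) (hy : 1 ≤ y.order)
    (hz : 1 ≤ z.order) : 3 ≤ (t * (x * y * z)).order :=
  calc (3 : ℕ∞) = 0 + (1 + 1 + 1) := by norm_num
    _ ≤ t.order + (x.order + y.order + z.order) := by gcongr; exact zero_le
    _ ≤ t.order + ((x * y).order + z.order) := by gcongr; exact MvPowerSeries.le_order_mul
    _ ≤ t.order + (x * y * z).order := by gcongr; exact MvPowerSeries.le_order_mul
    _ ≤ _ := MvPowerSeries.le_order_mul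

/-- A triple point is not a rational double point. -/
theorem not_isK3Quartic_of_triple_point {F : MvPolynomial (Fin 4) k} {B : GL (Fin 4) k} {c : k}
    (hB : changeCoords B F = secondKindQuartic 0 ![0, 0, 0, 0, c]) : ¬ IsK3Quartic F := by
  intro hK
  set H : MvPolynomial (Fin 4) k := secondKindQuartic 0 ![0, 0, 0, 0, c] with hH
  have hH' : H = X 0 * (X 3 * X 3 * X 3) + X 1 * (X 2 * X 2 * X 2) +
      C c * X 1 * (X 1 * X 1 * X 1) := by
    simp [hH, secondKindQuartic]
    ring
  have hF : F = changeCoords B⁻¹ H := by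
    rw [← hB, changeCoords_changeCoords, mul_inv_cancel, changeCoords_one]
  have hBe : ((B⁻¹ : GL (Fin 4) k) : Matrix (Fin 4) (Fin 4) k).mulVec
      ((B : Matrix (Fin 4) (Fin 4) k).mulVec (Pi.single 0 1)) = Pi.single 0 1 := by
    rw [Matrix.mulVec_mulVec, ← Units.val_mul, inv_mul_cancel, Units.val_one, Matrix.one_mulVec]
  have hsing : IsSingularPoint F ((B : Matrix (Fin 4) (Fin 4) k).mulVec (Pi.single 0 1)) := by
    refine ⟨?_, ?_, ?_⟩
    · intro h
      rw [h, Matrix.mulVec_zero] at hBe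
      simpa using congrFun hBe 0
    · rw [hF, eval_changeCoords, hBe, hH']
      simp
    · intro i
      rw [hF, changeCoords, pderiv_bind₁, map_sum]
      refine Finset.sum_eq_zero fun j _ => ?_
      have h0 : eval ((B : Matrix (Fin 4) (Fin 4) k).mulVec (Pi.single 0 1))
          (changeCoords B⁻¹ (pderiv j H)) = 0 := by
        rw [eval_changeCoords, hBe, hH']
        fin_cases j <;> simp [pderiv_X, Derivation.leibniz]
      rw [map_mul]
      rw [changeCoords] at h0
      rw [h0, zero_mul]
  obtain ⟨A, hA, φ, g, hg, hass⟩ := hK.rationalDoublePoint _ hsing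
  rw [hF, changeCoords_changeCoords] at hass
  set T := B⁻¹ * A with hT
  -- The frame `A` sends the last basis vector to the triple point, so `T` sends it to e₀. Thus the
  -- affine forms ℓ₁, ℓ₂, ℓ₃ vanish at the origin.
  have hTe : ∀ i, T.1 i 3 = (Pi.single 0 1 : Fin 4 → k) i := by
    intro i
    rw [← hBe, ← hA, Matrix.mulVec_mulVec, ← Units.val_mul, ← hT, Matrix.mulVec_single_one]
    rfl
  -- the coordinates of the generic point near the triple point
  set ℓ : Fin 4 → MvPolynomial (Fin 3) k :=
    fun i => bind₁ ![X 0, X 1, X 2, 1] (∑ j, C (T.1 i j) * X j) with hℓ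
  have hℓ0 : ∀ i, i ≠ 0 → MvPowerSeries.constantCoeff (ℓ i : MvPowerSeries (Fin 3) k) = 0 := by
    intro i hi
    rw [← MvPowerSeries.coeff_zero_eq_constantCoeff_apply, MvPolynomial.coeff_coe,
      ← constantCoeff_eq]
    simp [hℓ, Fin.sum_univ_four, hTe, hi]
  have hf : bind₁ ![X 0, X 1, X 2, 1] (changeCoords T H) =
      ℓ 0 * (ℓ 3 * ℓ 3 * ℓ 3) + ℓ 1 * (ℓ 2 * ℓ 2 * ℓ 2) + C c * ℓ 1 * (ℓ 1 * ℓ 1 * ℓ 1) := by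
    rw [changeCoords, bind₁_bind₁, hH']
    simp only [map_add, map_mul, bind₁_X_right, bind₁_C_right, hℓ]
  have hord : ∀ i, i ≠ 0 → 1 ≤ (φ (ℓ i : MvPowerSeries (Fin 3) k)).order :=
    fun i hi => one_le_order_algEquiv φ (hℓ0 i hi)
  have h3 : 3 ≤ (φ (bind₁ ![X 0, X 1, X 2, 1] (changeCoords T H) : MvPolynomial (Fin 3) k)).order := by
    rw [hf]
    simp only [MvPolynomial.coe_add, MvPolynomial.coe_mul, map_add, map_mul]
    have h1 := hord 1 (by decide)
    have h2 := hord 2 (by decide)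
    have h3 := hord 3 (by decide)
    exact le_trans (le_min (le_trans (le_min (three_le_order h3 h3 h3) (three_le_order h2 h2 h2))
      MvPowerSeries.min_order_le_add) (three_le_order h1 h1 h1)) MvPowerSeries.min_order_le_add
  -- Multiplying by a unit does not lower the order, so the normal form would have order at least 3.
  obtain ⟨u, hu⟩ := hass
  have h3' : 3 ≤ (g : MvPowerSeries (Fin 3) k).order := by
    rw [← hu]
    exact le_trans (le_trans h3 le_self_add) MvPowerSeries.le_order_mul
  exact absurd (h3'.trans (order_le_two_of_ADENormalForm hg)) (by decide)

/-- A surface with two intersecting lines of the second kind, both of degree 3 with two points of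
ramification, is projectively equivalent to Schur's quartic. -/
theorem projectivelyEquivalent_schurQuartic [IsAlgClosed k] (h2 : (2 : k) ≠ 0) (h3 : (3 : k) ≠ 0)
    (F : MvPolynomial (Fin 4) k) (hF : IsK3Quartic F)
    (l m : Submodule k (Fin 4 → k))
    (hl : IsLineOn F l) (hm : IsLineOn F m)
    (hne : l ≠ m) (hinter : l ⊓ m ≠ ⊥)
    (hdegl : HasDegree F l 3) (hdegm : HasDegree F m 3)
    (hraml : HasRamificationCount F l 2) (hramm : HasRamificationCount F m 2)
    (hkindl : IsSecondKind F l) (hkindm : IsSecondKind F m) :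
    ProjectivelyEquivalent F (schurQuartic k) := by
  have : Infinite k := IsAlgClosed.instInfinite
  obtain ⟨B, v, g, hv, hB⟩ := exists_diagonal_form h2 h3 hF.isHomogeneous hl hm hne hinter hdegl
    hdegm hraml hramm hkindl hkindm
  have hg : g ≠ 0 := by
    rintro rfl
    exact not_isK3Quartic_of_triple_point hB hF
  -- The scalings solve g a⁴ = 1, v³b⁴ = 1, b c³ = 1 and a d³ = -1, matching the four terms of
  -- Schur's quartic.
  obtain ⟨a, ha⟩ := IsAlgClosed.exists_pow_nat_eq g⁻¹ (n := 4) (by norm_num)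
  obtain ⟨b, hb⟩ := IsAlgClosed.exists_pow_nat_eq (v ^ 3)⁻¹ (n := 4) (by norm_num)
  obtain ⟨c, hc⟩ := IsAlgClosed.exists_pow_nat_eq b⁻¹ (n := 3) (by norm_num)
  obtain ⟨d, hd⟩ := IsAlgClosed.exists_pow_nat_eq (-a⁻¹) (n := 3) (by norm_num)
  have ha0 : a ≠ 0 := fun h => inv_ne_zero hg (by rw [← ha, h]; ring)
  have hb0 : b ≠ 0 := fun h => inv_ne_zero (pow_ne_zero 3 hv) (by rw [← hb, h]; ring)
  have hc0 : c ≠ 0 := fun h => inv_ne_zero hb0 (by rw [← hc, h]; ring)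
  have hd0 : d ≠ 0 := fun h => neg_ne_zero.2 (inv_ne_zero ha0) (by rw [← hd, h]; ring)
  have hdet : (Matrix.diagonal ![a, b, c, d]).det ≠ 0 := by
    rw [Matrix.det_diagonal, Fin.prod_univ_four]
    exact mul_ne_zero (mul_ne_zero (mul_ne_zero ha0 hb0) hc0) hd0
  refine ⟨B * Matrix.GeneralLinearGroup.mkOfDetNeZero _ hdet, 1, one_ne_zero, ?_⟩
  rw [← changeCoords_changeCoords, hB, C_1, one_mul]
  refine MvPolynomial.funext fun x => ?_
  have hS : (Matrix.GeneralLinearGroup.mkOfDetNeZero _ hdet : Matrix (Fin 4) (Fin 4) k) =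
    Matrix.diagonal ![a, b, c, d] := rfl
  have hx : (Matrix.diagonal ![a, b, c, d]).mulVec x = ![a * x 0, b * x 1, c * x 2, d * x 3] := by
    ext i
    rw [Matrix.mulVec_diagonal]
    fin_cases i <;> rfl
  rw [eval_changeCoords, hS, hx]
  simp [secondKindQuartic, schurQuartic]
  have ha' : g * a ^ 4 = 1 := by rw [ha, mul_inv_cancel₀ hg]
  have hb' : v ^ 3 * b ^ 4 = 1 := by rw [hb, mul_inv_cancel₀ (pow_ne_zero 3 hv)]
  have hc' : b * c ^ 3 = 1 := by rw [hc, mul_inv_cancel₀ hb0]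
  have hd' : a * d ^ 3 = -1 := by rw [hd, mul_neg, mul_inv_cancel₀ ha0]
  linear_combination x 0 ^ 4 * ha' - x 1 ^ 4 * hb' + x 1 * x 2 ^ 3 * hc' + x 0 * x 3 ^ 3 * hd'

end

end K3Quartic

theorem proposition4p4 {k : Type*} [Field k] [IsAlgClosed k] (h2 : (2 : k) ≠ 0) (h3 : (3 : k) ≠ 0)
    (F : MvPolynomial (Fin 4) k) (hF : K3Quartic.IsK3Quartic F)
    (l m : Submodule k (Fin 4 → k))
    (hl : K3Quartic.IsLineOn F l) (hm : K3Quartic.IsLineOn F m)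
    (hne : l ≠ m) (hinter : l ⊓ m ≠ ⊥)
    (hdegl : K3Quartic.HasDegree F l 3) (hdegm : K3Quartic.HasDegree F m 3)
    (hraml : K3Quartic.HasRamificationCount F l 2) (hramm : K3Quartic.HasRamificationCount F m 2)
    (hkindl : K3Quartic.IsSecondKind F l) (hkindm : K3Quartic.IsSecondKind F m) :
    K3Quartic.ProjectivelyEquivalent F (K3Quartic.schurQuartic k) :=
  K3Quartic.projectivelyEquivalent_schurQuartic h2 h3 F hF l m hl hm hne hinter hdegl hdegm hraml
    hramm hkindl hkindm
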